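/- **Gauge-fixed stationary distribution on a slice.** Let $(\Theta,g)$ be an $n$-dimensional smooth Riemannian manifold (Hausdorff, second countable, without boundary), and let $\mathcal G$ be a Lie group of dimension $m$ acting smoothly, freely and properly on $\Theta$ from the left. Let $\chi:\Theta\to\mathbb R^m$ be a smooth map whose differential $d\chi_\theta$ is surjective at every point of the slice $\mathcal S:=\chi^{-1}(0)$; assume that $\mathcal S$ is an embedded submanifold of $\Theta$ that meets each $\mathcal G$-orbit exactly once and transversally, i.e. $T_\theta\mathcal S+T_\theta(\mathcal G\cdot\theta)=T_\theta\Theta$ for all $\theta\in\mathcal S$. Let $L:\Theta\to\mathbb R$ be smooth and $\mathcal G$-invariant, let $\beta,\sigma>0$, and consider the Langevin equation $$d\theta_t=-\nabla L(\theta_t)\,dt+\sqrt{2/\beta}\,\sigma\,dW_t ,$$ understood on $\Theta$ as the martingale problem for the generator $f\mapsto -g(\nabla L,\nabla f)+\frac{\sigma^2}{\beta}\Delta_g f$, where $\Delta_g$ is the Laplace–Beltrami operator. Assume that it has a solution, defined for all times $t\ge 0$, whose law at every time is the probability measure $$\mu_\infty(d\theta)=Z^{-1}e^{-\frac{\beta}{\sigma^2}L(\theta)}\,d\mathrm{Vol}_\Theta(\theta),\qquad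 Z>0 .$$ Let $G_\chi(\theta)_{ij}=g_\theta(\nabla\chi^i(\theta),\nabla\chi^j(\theta))$, let $\mathrm{Vol}_{\mathcal S}$ be the Riemannian volume of the metric induced on $\mathcal S$, and put $$Z_{\mathcal S}=\int_{\mathcal S}e^{-\frac{\beta}{\sigma^2}L}\,(\det G_\chi)^{-1/2}\,d\mathrm{Vol}_{\mathcal S}.$$ The *constrained measure* $\delta^{(m)}(\chi)\,\mu_\infty$ is the locally finite measure $\nu$ on $\mathcal S$ with $$\lim_{\varepsilon\downarrow0}\int_\Theta f\,\varepsilon^{-m}\eta(\chi/\varepsilon)\,d\mu_\infty=\int_{\mathcal S}f\,d\nu$$ for every continuous compactly supported $f:\Theta\to\mathbb R$ and every bounded measurable compactly supported $\eta:\mathbb R^m\to\mathbb R$ with $\int\eta=1$. A probability measure on $\mathcal S$ is the *conditional (gauge-fixed) stationary law* of $\mu_\infty$ on $\mathcal S$ if a positive multiple of it is the constrained measure. Then: 1. $\det G_\chi>0$ on $\mathcal S$, and the constrained measure exists and equals $Z^{-1}e^{-\frac{\beta}{\sigma^2}L}(\det G_\chi)^{-1/2}\,d\mathrm{Vol}_{\mathcal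 S}$. 2. $Z_{\mathcal S}>0$, and the conditional law on $\mathcal S$ exists if and only if $Z_{\mathcal S}<\infty$. 3. When it exists, the conditional law is absolutely continuous with respect to $\mathrm{Vol}_{\mathcal S}$, and its density is $$\rho_{\mathcal S}(\theta)=Z_{\mathcal S}^{-1}\,e^{-\frac{\beta}{\sigma^2}L(\theta)}\,\frac{1}{\sqrt{\det G_\chi(\theta)}} ;$$ equivalently, $$\rho_{\mathcal S}(\theta)\propto\exp\!\Big(-\frac{\beta}{\sigma^2}\Big(L(\theta)+\frac{\sigma^2}{2\beta}\log\det G_\chi(\theta)\Big)\Big),\qquad\theta\in\mathcal S .$$ -/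

import Mathlib

open MeasureTheory ProbabilityTheory Filter Bundle
open scoped Manifold ContDiff Topology NNReal ENNReal

noncomputable section

namespace GaugeSlice

section Volume

variable {n : ℕ} {M : Type*} [TopologicalSpace M] [ChartedSpace (EuclideanSpace ℝ (Fin n)) M]

/-- A (not necessarily smooth) field of real-valued forms in two tangent vectors on an
`n`-dimensional manifold; metric tensors are given in this form. -/
abbrev TensorField (n : ℕ) (M : Type*) [TopologicalSpace M]
    [ChartedSpace (EuclideanSpace ℝ (Fin n)) M] : Type _ :=
  (x : M) → TangentSpace (𝓡 n) x → TangentSpace (𝓡 n) x → ℝ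

/-- The `i`-th coordinate vector `∂ᵢ` of the chart at `x₀`, at the point with coordinates `u`. -/
def coordVector (x₀ : M) (u : EuclideanSpace ℝ (Fin n)) (i : Fin n) :
    TangentSpace (𝓡 n) ((chartAt (EuclideanSpace ℝ (Fin n)) x₀).symm u) :=
  mfderiv (𝓡 n) (𝓡 n) (chartAt (EuclideanSpace ℝ (Fin n)) x₀).symm u
    (EuclideanSpace.single i (1 : ℝ))

/-- The matrix `gᵢⱼ(u) = g(∂ᵢ, ∂ⱼ)` of `g` in the chart at `x₀`. -/
def metricMatrix (g : TensorField n M) (x₀ : M) (u : EuclideanSpace ℝ (Fin n)) :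
    Matrix (Fin n) (Fin n) ℝ :=
  Matrix.of fun i j ↦ g _ (coordVector x₀ u i) (coordVector x₀ u j)

/-- `√(det gᵢⱼ(u))` in the chart at `x₀`. -/
def sqrtDet (g : TensorField n M) (x₀ : M) (u : EuclideanSpace ℝ (Fin n)) : ℝ :=
  √(metricMatrix g x₀ u).det

/-- The measure `√(det gᵢⱼ) du¹ ⋯ duⁿ` on the domain of the chart at `x₀`, extended by zero to the
whole manifold. -/
def chartVolume [MeasurableSpace M] (g : TensorField n M) (x₀ : M) : Measure M :=
  ((volume.restrict (chartAt (EuclideanSpace ℝ (Fin n)) x₀).target).withDensity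
    fun u ↦ ENNReal.ofReal (sqrtDet g x₀ u)).map (chartAt (EuclideanSpace ℝ (Fin n)) x₀).symm

/-- The Riemannian volume measure of the metric `g`: the least measure that dominates
`√(det gᵢⱼ) du¹ ⋯ duⁿ` on every chart domain. The chart measures agree on overlaps, so on a
second countable manifold this is the measure that equals `√(det gᵢⱼ) du¹ ⋯ duⁿ` in each chart. -/
def riemannianVolume [MeasurableSpace M] (g : TensorField n M) : Measure M :=
  ⨆ x₀ : M, chartVolume g x₀

/-- The Laplace-Beltrami operator, `Δf = (det g)^(-1/2) ∂ᵢ ((det g)^(1/2) gⁱʲ ∂ⱼ f)`, evaluated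
at `x` in the chart at `x`. -/
def laplaceBeltrami (g : TensorField n M) (f : M → ℝ) (x : M) : ℝ :=
  (sqrtDet g x (chartAt (EuclideanSpace ℝ (Fin n)) x x))⁻¹ *
    ∑ i, fderiv ℝ
      (fun u ↦ sqrtDet g x u * ∑ j, (metricMatrix g x u)⁻¹ i j *
        fderiv ℝ (f ∘ (chartAt (EuclideanSpace ℝ (Fin n)) x).symm) u
          (EuclideanSpace.single j (1 : ℝ)))
      (chartAt (EuclideanSpace ℝ (Fin n)) x x) (EuclideanSpace.single i (1 : ℝ))

end Volume

section Riemannian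

variable {n : ℕ} {Θ : Type*} [TopologicalSpace Θ] [ChartedSpace (EuclideanSpace ℝ (Fin n)) Θ]
  [IsManifold (𝓡 n) ∞ Θ] [RiemannianBundle (fun x : Θ ↦ TangentSpace (𝓡 n) x)]

/-- The metric tensor of a Riemannian manifold. -/
def metricTensor (n : ℕ) (Θ : Type*) [TopologicalSpace Θ]
    [ChartedSpace (EuclideanSpace ℝ (Fin n)) Θ] [IsManifold (𝓡 n) ∞ Θ]
    [RiemannianBundle (fun x : Θ ↦ TangentSpace (𝓡 n) x)] : TensorField n Θ :=
  fun _ v w ↦ inner ℝ v w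

/-- The pull-back of the metric tensor of `Θ` under a map `ι : S → Θ`. -/
def inducedMetric {k : ℕ} {S : Type*} [TopologicalSpace S]
    [ChartedSpace (EuclideanSpace ℝ (Fin k)) S] (ι : S → Θ) : TensorField k S :=
  fun s v w ↦ metricTensor n Θ (ι s) (mfderiv (𝓡 k) (𝓡 n) ι s v) (mfderiv (𝓡 k) (𝓡 n) ι s w)

/-- The differential of a real-valued function as a linear form on the tangent space. -/
def differential (f : Θ → ℝ) (θ : Θ) : TangentSpace (𝓡 n) θ →L[ℝ] ℝ :=
  mfderiv (𝓡 n) 𝓘(ℝ, ℝ) f θ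

/-- The Riemannian gradient: `g(∇f, v) = df(v)` for every tangent vector `v`. -/
def grad (f : Θ → ℝ) (θ : Θ) : TangentSpace (𝓡 n) θ :=
  haveI : FiniteDimensional ℝ (TangentSpace (𝓡 n) θ) :=
    inferInstanceAs (FiniteDimensional ℝ (EuclideanSpace ℝ (Fin n)))
  haveI : CompleteSpace (TangentSpace (𝓡 n) θ) := FiniteDimensional.complete ℝ _
  (InnerProductSpace.toDual ℝ (TangentSpace (𝓡 n) θ)).symm (differential f θ)

/-- The constraint Gram matrix `G_χ(θ)ᵢⱼ = g(∇χⁱ(θ), ∇χʲ(θ))`. -/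
def constraintGram {m : ℕ} (χ : Θ → EuclideanSpace ℝ (Fin m)) (θ : Θ) :
    Matrix (Fin m) (Fin m) ℝ :=
  Matrix.of fun i j ↦
    metricTensor n Θ θ (grad (n := n) (fun x ↦ χ x i) θ) (grad (n := n) (fun x ↦ χ x j) θ)

/-- The generator of the Langevin dynamics `dθ = -∇L dt + √(2/β) σ dW`:
`f ↦ -g(∇L, ∇f) + (σ²/β) Δf`. -/
def langevinGenerator (L : Θ → ℝ) (β σ : ℝ) (f : Θ → ℝ) (θ : Θ) : ℝ :=
  -metricTensor n Θ θ (grad (n := n) L θ) (grad (n := n) f θ) +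
    σ ^ 2 / β * laplaceBeltrami (metricTensor n Θ) f θ

/-- `X` is a (non-exploding) solution of the Langevin equation `dθ = -∇L dt + √(2/β) σ dW` on the
Riemannian manifold `Θ`: an adapted continuous process that solves the martingale problem of its
generator on smooth compactly supported functions. -/
structure IsLangevinProcess (n : ℕ) {Θ : Type*} [TopologicalSpace Θ]
    [ChartedSpace (EuclideanSpace ℝ (Fin n)) Θ] [IsManifold (𝓡 n) ∞ Θ]
    [RiemannianBundle (fun x : Θ ↦ TangentSpace (𝓡 n) x)] [MeasurableSpace Θ]
    (L : Θ → ℝ) (β σ : ℝ) {Ω : Type*} [mΩ : MeasurableSpace Ω] (P : Measure Ω)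
    (ℱ : Filtration ℝ≥0 mΩ) (X : ℝ≥0 → Ω → Θ) : Prop where
  adapted : ∀ t, Measurable[ℱ t] (X t)
  continuous_paths : ∀ᵐ w ∂P, Continuous fun t ↦ X t w
  martingale : ∀ f : Θ → ℝ, ContMDiff (𝓡 n) 𝓘(ℝ, ℝ) ∞ f → HasCompactSupport f →
    Martingale (fun (t : ℝ≥0) w ↦ f (X t w) - f (X 0 w) -
      ∫ s in (0 : ℝ)..t, langevinGenerator (n := n) L β σ f (X s.toNNReal w)) ℱ P

end Riemannian

section Slice

variable {m : ℕ}

/-- The tangent space at `θ` of the orbit of `θ`: the range of the differential of `a ↦ a • θ` at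
the identity. -/
def orbitTangent (n m : ℕ) {Θ : Type*} [TopologicalSpace Θ]
    [ChartedSpace (EuclideanSpace ℝ (Fin n)) Θ] (G : Type*) [TopologicalSpace G]
    [ChartedSpace (EuclideanSpace ℝ (Fin m)) G] [Group G] [MulAction G Θ] (θ : Θ) :
    Submodule ℝ (TangentSpace (𝓡 n) θ) :=
  LinearMap.range (M₂ := EuclideanSpace ℝ (Fin n))
    (mfderiv (𝓡 m) (𝓡 n) (fun a : G ↦ a • θ) 1).toLinearMap

/-- The tangent space of the slice `χ⁻¹(0)`, as a subspace of the tangent space of `Θ`. -/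
def sliceTangent (n k : ℕ) {Θ : Type*} [TopologicalSpace Θ]
    [ChartedSpace (EuclideanSpace ℝ (Fin n)) Θ] (χ : Θ → EuclideanSpace ℝ (Fin m))
    [ChartedSpace (EuclideanSpace ℝ (Fin k)) (χ ⁻¹' {0})] (s : χ ⁻¹' {0}) :
    Submodule ℝ (TangentSpace (𝓡 n) (s : Θ)) :=
  LinearMap.range (mfderiv (𝓡 k) (𝓡 n) (Subtype.val : χ ⁻¹' {0} → Θ) s).toLinearMap

/-- The Riemannian volume measure of the slice `χ⁻¹(0)`, for the metric induced from `Θ`. -/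
def sliceVolume (n k : ℕ) {Θ : Type*} [TopologicalSpace Θ]
    [ChartedSpace (EuclideanSpace ℝ (Fin n)) Θ] [IsManifold (𝓡 n) ∞ Θ]
    [RiemannianBundle (fun x : Θ ↦ TangentSpace (𝓡 n) x)] [MeasurableSpace Θ]
    (χ : Θ → EuclideanSpace ℝ (Fin m)) [ChartedSpace (EuclideanSpace ℝ (Fin k)) (χ ⁻¹' {0})] :
    Measure (χ ⁻¹' {0}) :=
  riemannianVolume (inducedMetric (n := n) (k := k) (Subtype.val : χ ⁻¹' {0} → Θ))

/-- `exp(-(β/σ²) L) / √(det G_χ)`. -/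
def sliceWeight (n : ℕ) {Θ : Type*} [TopologicalSpace Θ]
    [ChartedSpace (EuclideanSpace ℝ (Fin n)) Θ] [IsManifold (𝓡 n) ∞ Θ]
    [RiemannianBundle (fun x : Θ ↦ TangentSpace (𝓡 n) x)]
    (L : Θ → ℝ) (β σ : ℝ) (χ : Θ → EuclideanSpace ℝ (Fin m)) (θ : Θ) : ℝ :=
  Real.exp (-(β / σ ^ 2) * L θ) * (1 / √(constraintGram (n := n) χ θ).det)

/-- The effective loss `L + (σ²/2β) log det G_χ`. -/
def effectiveLoss (n : ℕ) {Θ : Type*} [TopologicalSpace Θ]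
    [ChartedSpace (EuclideanSpace ℝ (Fin n)) Θ] [IsManifold (𝓡 n) ∞ Θ]
    [RiemannianBundle (fun x : Θ ↦ TangentSpace (𝓡 n) x)]
    (L : Θ → ℝ) (β σ : ℝ) (χ : Θ → EuclideanSpace ℝ (Fin m)) (θ : Θ) : ℝ :=
  L θ + σ ^ 2 / (2 * β) * Real.log (constraintGram (n := n) χ θ).det

/-- The measure with density proportional to `ρ` and total mass one; this is meant for
`0 < ∫ ρ dv < ∞`. -/
def normalizedDensity {S : Type*} [MeasurableSpace S] (v : Measure S) (ρ : S → ℝ) : Measure S :=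
  v.withDensity fun s ↦ (∫⁻ x, ENNReal.ofReal (ρ x) ∂v)⁻¹ * ENNReal.ofReal (ρ s)

end Slice

section Conditioning

variable {Θ : Type*} [TopologicalSpace Θ] [MeasurableSpace Θ] {m : ℕ}

/-- `ν`, a measure on the slice `χ⁻¹(0)`, is the constrained measure `δ⁽ᵐ⁾(χ) dμ`: it is locally
finite, and for every bounded measurable compactly supported `η` with integral one, the measures
`ε⁻ᵐ η(χ / ε) dμ` converge to `ν` as `ε → 0+`, tested against continuous compactly supported
functions. Smooth mollifiers `η` give the Dirac delta; the normalized indicator of the unit ball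
gives the restrictions of `μ` to the thin tubes `‖χ‖ ≤ ε`, divided by the volume of the `ε`-ball. -/
structure IsConstrainedMeasure (μ : Measure Θ) (χ : Θ → EuclideanSpace ℝ (Fin m))
    (ν : Measure (χ ⁻¹' {0})) : Prop where
  locallyFinite : IsLocallyFiniteMeasure ν
  tendsto : ∀ η : EuclideanSpace ℝ (Fin m) → ℝ, Measurable η → (∃ C, ∀ y, |η y| ≤ C) →
    HasCompactSupport η → ∫ y, η y = 1 →
    ∀ f : Θ → ℝ, Continuous f → HasCompactSupport f →
      Tendsto (fun ε : ℝ ↦ ∫ θ, f θ * ((ε ^ m)⁻¹ * η (ε⁻¹ • χ θ)) ∂μ) (𝓝[>] 0)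
        (𝓝 (∫ s, f s ∂ν))

/-- `ν` is the conditional law of `μ` on the slice `χ⁻¹(0)`: a probability measure that is
proportional to the constrained measure `δ⁽ᵐ⁾(χ) dμ`. -/
def IsConditionalLaw (μ : Measure Θ) (χ : Θ → EuclideanSpace ℝ (Fin m))
    (ν : Measure (χ ⁻¹' {0})) : Prop :=
  IsProbabilityMeasure ν ∧ ∃ c : ℝ≥0, 0 < c ∧ IsConstrainedMeasure μ χ (c • ν)

end Conditioning

end GaugeSlice

end

open GaugeSlice

/-! The statement is local, and becomes a computation in a chart adapted to the slice. Since `dχ` is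
onto along the slice, the inverse function theorem gives, around each slice point, coordinates `(y,
u)` of `Θ` with `y = χ` in which `u` restricts to a chart of the slice (`exists_adapted_chart`). The
required dimension count `m + k = n` has two halves: tangent vectors of the slice are killed by
`dχ`, so `m + k ≤ n`, and transversality to an orbit of dimension at most `m` gives `n ≤ m + k`.

In such coordinates `μ` has a continuous density `J ρ` against `dy du`, with `J = √det g` and `ρ`
the Gibbs density, and the mollifier depends on `y` alone. Rescaling `y` and dominated convergence
give the limit `∫ (J ρ f)(0, u) du` (`tendsto_integral_mul_mollifier`).

It remains to compare `J` with the volume density `J_S` of the slice. The gradients `∇χⁱ` are dual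
to the `∂/∂yʲ` and orthogonal to the `∂/∂uʲ`, so `G_χ` is the `y`-block of the inverse Gram matrix
of the frame. The complementary minor formula (`det_gram_sumElim_mul_det_gram`) yields `J √det G_χ =
J_S`, so the limit is the integral of `f ρ (det G_χ)^(-1/2)` over the slice.

A partition of unity globalizes this (`isConstrainedMeasure_of_local`); off the slice the mollified
integrals are eventually zero. A constrained measure is determined by its integrals of test
functions (`IsConstrainedMeasure.unique`), so a conditional law can only be its normalization, which
exists exactly when the mass is finite. -/

noncomputable section

namespace GaugeSlice

/-! ### Riemannian volume in an arbitrary smooth chart. -/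

section ChartVolume

variable {n : ℕ} {M : Type*} [TopologicalSpace M] [ChartedSpace (EuclideanSpace ℝ (Fin n)) M]

/-- The differential of the inverse of a chart, as an endomorphism of the model space. -/
def frameMap (e : OpenPartialHomeomorph M (EuclideanSpace ℝ (Fin n)))
    (u : EuclideanSpace ℝ (Fin n)) : EuclideanSpace ℝ (Fin n) →L[ℝ] EuclideanSpace ℝ (Fin n) :=
  mfderiv (𝓡 n) (𝓡 n) e.symm u

/-- The value of a tensor field on two vectors of the model space. -/
def TensorField.val (g : TensorField n M) (x : M) (v w : EuclideanSpace ℝ (Fin n)) : ℝ := g x v w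

/-- The matrix of a tensor field in an arbitrary chart. -/
def chartGram (g : TensorField n M) (e : OpenPartialHomeomorph M (EuclideanSpace ℝ (Fin n)))
    (u : EuclideanSpace ℝ (Fin n)) : Matrix (Fin n) (Fin n) ℝ :=
  Matrix.of fun i j ↦ g.val (e.symm u) (frameMap e u (EuclideanSpace.single i (1 : ℝ)))
    (frameMap e u (EuclideanSpace.single j (1 : ℝ)))

/-- The volume density of a tensor field in an arbitrary chart. -/
def chartDensity (g : TensorField n M) (e : OpenPartialHomeomorph M (EuclideanSpace ℝ (Fin n)))
    (u : EuclideanSpace ℝ (Fin n)) : ℝ :=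
  √(chartGram g e u).det

/-- The volume measure of a tensor field in an arbitrary chart. -/
def localVolume [MeasurableSpace M] (g : TensorField n M)
    (e : OpenPartialHomeomorph M (EuclideanSpace ℝ (Fin n))) : Measure M :=
  ((volume.restrict e.target).withDensity fun u ↦ ENNReal.ofReal (chartDensity g e u)).map e.symm

lemma chartVolume_eq_localVolume [MeasurableSpace M] (g : TensorField n M) (x : M) :
    chartVolume g x = localVolume g (chartAt _ x) := rfl

/-- Tensor fields that are bilinear and have continuous components in every chart. -/
structure TensorField.IsRegular (g : TensorField n M) : Prop where
  bilinear : ∀ x, ∃ B : LinearMap.BilinForm ℝ (EuclideanSpace ℝ (Fin n)), ∀ v w, g.val x v w = B v w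
  continuousOn : ∀ e ∈ IsManifold.maximalAtlas (𝓡 n) ∞ M,
    ContinuousOn (fun u ↦ chartGram g e u) e.target

lemma chartGram_eq_toMatrix {g : TensorField n M}
    {e : OpenPartialHomeomorph M (EuclideanSpace ℝ (Fin n))} {u : EuclideanSpace ℝ (Fin n)}
    {B : LinearMap.BilinForm ℝ (EuclideanSpace ℝ (Fin n))}
    (hB : ∀ v w, g.val (e.symm u) v w = B v w) :
    chartGram g e u = LinearMap.BilinForm.toMatrix (EuclideanSpace.basisFun (Fin n) ℝ).toBasis
      (B.comp (frameMap e u).toLinearMap (frameMap e u).toLinearMap) := by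
  ext i j
  simp [chartGram, hB, LinearMap.BilinForm.toMatrix_apply]

/-- Chain rule for `e.symm = e'.symm ∘ (e' ∘ e.symm)`, valid near `u`. The first component is the
form needed by the change of variables formula. -/
lemma frameMap_eq_comp_fderiv {e e' : OpenPartialHomeomorph M (EuclideanSpace ℝ (Fin n))}
    [IsManifold (𝓡 n) ∞ M]
    (he : e ∈ IsManifold.maximalAtlas (𝓡 n) ∞ M) (he' : e' ∈ IsManifold.maximalAtlas (𝓡 n) ∞ M)
    {u : EuclideanSpace ℝ (Fin n)} (hu : u ∈ e.target) (hu' : e.symm u ∈ e'.source) :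
    HasFDerivAt (e' ∘ e.symm) (fderiv ℝ (e' ∘ e.symm) u) u ∧
    frameMap e u = (frameMap e' (e' (e.symm u))).comp (fderiv ℝ (e' ∘ e.symm) u) := by
  have h1 : MDifferentiableAt (𝓡 n) (𝓡 n) e.symm u :=
    (contMDiffAt_symm_of_mem_maximalAtlas he hu).mdifferentiableAt (by simp)
  have h2 : MDifferentiableAt (𝓡 n) (𝓡 n) e' (e.symm u) :=
    (contMDiffAt_of_mem_maximalAtlas he' hu').mdifferentiableAt (by simp)
  have h3 : MDifferentiableAt (𝓡 n) (𝓡 n) e'.symm (e' (e.symm u)) :=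
    (contMDiffAt_symm_of_mem_maximalAtlas he' (e'.map_source hu')).mdifferentiableAt (by simp)
  have h4 : MDifferentiableAt (𝓡 n) (𝓡 n) (e' ∘ e.symm) u := h2.comp u h1
  have hev : e.symm =ᶠ[𝓝 u] e'.symm ∘ (e' ∘ e.symm) := by
    have : ∀ᶠ v in 𝓝 u, e.symm v ∈ e'.source :=
      (e.continuousAt_symm hu).eventually (e'.open_source.mem_nhds hu')
    filter_upwards [this] with v hv
    simp [e'.left_inv hv]
  refine ⟨h4.differentiableAt.hasFDerivAt, ?_⟩
  unfold frameMap
  rw [hev.mfderiv_eq, mfderiv_comp u h3 h4, mfderiv_eq_fderiv]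
  rfl

/-- The two coordinate frames at a point differ by the Jacobian `T` of the transition map, so the
Gram matrices are congruent through `T`. The determinant gains `(det T)²`, and its root `|det T|`.
-/
lemma chartDensity_eq_abs_det_mul {g : TensorField n M} (hg : g.IsRegular)
    {e e' : OpenPartialHomeomorph M (EuclideanSpace ℝ (Fin n))}
    [IsManifold (𝓡 n) ∞ M]
    (he : e ∈ IsManifold.maximalAtlas (𝓡 n) ∞ M) (he' : e' ∈ IsManifold.maximalAtlas (𝓡 n) ∞ M)
    {u : EuclideanSpace ℝ (Fin n)} (hu : u ∈ e.target) (hu' : e.symm u ∈ e'.source) :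
    chartDensity g e u = |(fderiv ℝ (e' ∘ e.symm) u).det| * chartDensity g e' (e' (e.symm u)) := by
  obtain ⟨B, hB⟩ := hg.bilinear (e.symm u)
  have hB' : ∀ v w, g.val (e'.symm (e' (e.symm u))) v w = B v w := by
    rw [e'.left_inv hu']; exact hB
  obtain ⟨-, hf⟩ := frameMap_eq_comp_fderiv he he' hu hu'
  unfold chartDensity
  rw [chartGram_eq_toMatrix hB, chartGram_eq_toMatrix hB', hf]
  set D := frameMap e' (e' (e.symm u))
  set T := fderiv ℝ (e' ∘ e.symm) u
  have : B.comp (D.comp T).toLinearMap (D.comp T).toLinearMap =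
      (B.comp D.toLinearMap D.toLinearMap).comp T.toLinearMap T.toLinearMap := by
    ext; rfl
  rw [this, LinearMap.BilinForm.toMatrix_comp (EuclideanSpace.basisFun (Fin n) ℝ).toBasis,
    Matrix.det_mul, Matrix.det_mul, Matrix.det_transpose, LinearMap.det_toMatrix]
  rw [mul_right_comm, ← sq, Real.sqrt_mul (sq_nonneg _), Real.sqrt_sq_eq_abs]

-- Only continuity of `e.symm` on the target is known, so measurability goes through the subtype.
omit [ChartedSpace (EuclideanSpace ℝ (Fin n)) M] in
lemma measurableSet_target_inter_preimage_symm [MeasurableSpace M] [BorelSpace M]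
    (e : OpenPartialHomeomorph M (EuclideanSpace ℝ (Fin n))) {A : Set M} (hA : MeasurableSet A) :
    MeasurableSet (e.target ∩ e.symm ⁻¹' A) := by
  have h : Measurable (e.target.domRestrict e.symm) :=
    (continuousOn_iff_continuous_domRestrict.1 e.continuousOn_symm).measurable
  have := e.open_target.measurableSet.subtype_image (h hA)
  convert this using 1
  ext u
  simp [and_comm]

variable [MeasurableSpace M] [BorelSpace M]

omit [ChartedSpace (EuclideanSpace ℝ (Fin n)) M] in
lemma aemeasurable_symm (e : OpenPartialHomeomorph M (EuclideanSpace ℝ (Fin n))) :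
    AEMeasurable e.symm (volume.restrict e.target) :=
  e.continuousOn_symm.aemeasurable e.open_target.measurableSet

omit [ChartedSpace (EuclideanSpace ℝ (Fin n)) M] in
lemma aemeasurable_symm_withDensity (e : OpenPartialHomeomorph M (EuclideanSpace ℝ (Fin n)))
    (J : EuclideanSpace ℝ (Fin n) → ℝ≥0∞) :
    AEMeasurable e.symm ((volume.restrict e.target).withDensity J) :=
  (aemeasurable_symm e).mono_ac (withDensity_absolutelyContinuous _ _)

lemma localVolume_apply (g : TensorField n M)
    (e : OpenPartialHomeomorph M (EuclideanSpace ℝ (Fin n))) {A : Set M} (hA : MeasurableSet A) :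
    localVolume g e A =
      ∫⁻ u in e.target ∩ e.symm ⁻¹' A, ENNReal.ofReal (chartDensity g e u) := by
  rw [localVolume, Measure.map_apply_of_aemeasurable (aemeasurable_symm_withDensity _ _) hA]
  have h := measurableSet_target_inter_preimage_symm e hA
  have : ((volume.restrict e.target).withDensity
      fun u ↦ ENNReal.ofReal (chartDensity g e u)) (e.symm ⁻¹' A) =
      ((volume.restrict e.target).withDensity
      fun u ↦ ENNReal.ofReal (chartDensity g e u)) (e.target ∩ e.symm ⁻¹' A) := by
    rw [Set.inter_comm]
    refine (measure_inter_conull' (measure_mono_null (t := e.targetᶜ) (fun x hx ↦ hx.2) ?_)).symm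
    refine withDensity_absolutelyContinuous _ _ ?_
    simp [Measure.restrict_apply e.open_target.measurableSet.compl]
  rw [this, withDensity_apply _ h, Measure.restrict_restrict h,
    Set.inter_eq_self_of_subset_left Set.inter_subset_left]

lemma localVolume_apply_inter_source (g : TensorField n M)
    (e : OpenPartialHomeomorph M (EuclideanSpace ℝ (Fin n))) {A : Set M} (hA : MeasurableSet A) :
    localVolume g e (A ∩ e.source) = localVolume g e A := by
  rw [localVolume_apply g e hA, localVolume_apply g e (hA.inter e.open_source.measurableSet)]
  congr 2
  ext u
  constructor
  · rintro ⟨h1, h2, -⟩; exact ⟨h1, h2⟩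
  · rintro ⟨h1, h2⟩; exact ⟨h1, h2, e.map_target h1⟩

lemma localVolume_restrict_source (g : TensorField n M)
    (e : OpenPartialHomeomorph M (EuclideanSpace ℝ (Fin n))) :
    (localVolume g e).restrict e.source = localVolume g e := by
  ext A hA
  rw [Measure.restrict_apply hA, localVolume_apply_inter_source g e hA]

/-- Change of variables along the transition map, whose Jacobian is exactly the ratio of the two
densities. -/
lemma localVolume_apply_eq [IsManifold (𝓡 n) ∞ M] {g : TensorField n M} (hg : g.IsRegular)
    {e e' : OpenPartialHomeomorph M (EuclideanSpace ℝ (Fin n))}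
    (he : e ∈ IsManifold.maximalAtlas (𝓡 n) ∞ M) (he' : e' ∈ IsManifold.maximalAtlas (𝓡 n) ∞ M)
    {A : Set M} (hA : MeasurableSet A) (h : A ⊆ e.source) (h' : A ⊆ e'.source) :
    localVolume g e A = localVolume g e' A := by
  rw [localVolume_apply g e hA, localVolume_apply g e' hA]
  set s := e.target ∩ e.symm ⁻¹' A with hs_def
  have hs : MeasurableSet s := measurableSet_target_inter_preimage_symm e hA
  have himg : e'.target ∩ e'.symm ⁻¹' A = (e' ∘ e.symm) '' s := by
    ext v
    constructor
    · rintro ⟨h1, h2⟩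
      refine ⟨e (e'.symm v), ⟨e.map_source (h h2), ?_⟩, ?_⟩
      · simpa [e.left_inv (h h2)] using h2
      · simp [e.left_inv (h h2), e'.right_inv h1]
    · rintro ⟨u, ⟨h1, h2⟩, rfl⟩
      refine ⟨e'.map_source (h' h2), ?_⟩
      simpa [e'.left_inv (h' h2)] using h2
  have hinj : Set.InjOn (e' ∘ e.symm) s := by
    intro u hu v hv huv
    exact e.symm.injOn hu.1 hv.1 (e'.injOn (h' hu.2) (h' hv.2) huv)
  rw [himg, lintegral_image_eq_lintegral_abs_det_fderiv_mul volume hs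
    (fun u hu ↦ (frameMap_eq_comp_fderiv he he' hu.1 (h' hu.2)).1.hasFDerivWithinAt) hinj]
  refine setLIntegral_congr_fun hs fun u hu ↦ ?_
  simp only [Function.comp]
  rw [chartDensity_eq_abs_det_mul hg he he' hu.1 (h' hu.2), ENNReal.ofReal_mul (abs_nonneg _)]

lemma localVolume_restrict_comm [IsManifold (𝓡 n) ∞ M] {g : TensorField n M} (hg : g.IsRegular)
    {e e' : OpenPartialHomeomorph M (EuclideanSpace ℝ (Fin n))}
    (he : e ∈ IsManifold.maximalAtlas (𝓡 n) ∞ M) (he' : e' ∈ IsManifold.maximalAtlas (𝓡 n) ∞ M) :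
    (localVolume g e).restrict e'.source = (localVolume g e').restrict e.source := by
  ext A hA
  have h1 := e.open_source.measurableSet
  have h2 := e'.open_source.measurableSet
  rw [Measure.restrict_apply hA, Measure.restrict_apply hA,
    ← localVolume_apply_inter_source g e (hA.inter h2),
    ← localVolume_apply_inter_source g e' (hA.inter h1), Set.inter_right_comm A]
  exact localVolume_apply_eq hg he he' ((hA.inter h1).inter h2)
    (fun x hx ↦ hx.1.2) fun x hx ↦ hx.2

/-- In every smooth chart, the Riemannian volume is `√(det gᵢⱼ) du¹ ⋯ duⁿ`. -/
theorem riemannianVolume_restrict_source [IsManifold (𝓡 n) ∞ M] [SecondCountableTopology M]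
    {g : TensorField n M} (hg : g.IsRegular)
    {e : OpenPartialHomeomorph M (EuclideanSpace ℝ (Fin n))}
    (he : e ∈ IsManifold.maximalAtlas (𝓡 n) ∞ M) :
    (riemannianVolume g).restrict e.source = localVolume g e := by
  have hle : ∀ x, localVolume g (chartAt _ x) ≤ riemannianVolume g := fun x ↦
    le_iSup (fun x ↦ chartVolume g x) x
  have hatlas := fun x : M ↦ IsManifold.chart_mem_maximalAtlas (I := 𝓡 n) (n := ∞) x
  -- The volume of the chart `e`, plus the full volume off its domain, dominates every chart volume,
  -- hence also their supremum.
  have hupper : ∀ e ∈ IsManifold.maximalAtlas (𝓡 n) ∞ M,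
      (riemannianVolume g).restrict e.source ≤ localVolume g e := by
    intro e he
    have hm := e.open_source.measurableSet
    have : riemannianVolume g ≤
        localVolume g e + (riemannianVolume g).restrict e.sourceᶜ := by
      refine iSup_le fun x ↦ ?_
      rw [chartVolume_eq_localVolume,
        ← Measure.restrict_add_restrict_compl (μ := localVolume g (chartAt _ x)) hm]
      refine add_le_add ?_ (Measure.restrict_mono le_rfl (hle x))
      rw [localVolume_restrict_comm hg (hatlas x) he]
      exact Measure.restrict_le_self
    refine (Measure.restrict_mono le_rfl this).trans ?_
    rw [Measure.restrict_add, Measure.restrict_restrict hm]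
    simp [Measure.restrict_le_self]
  have hchart : ∀ x, (riemannianVolume g).restrict (chartAt (EuclideanSpace ℝ (Fin n)) x).source =
      localVolume g (chartAt _ x) := fun x ↦ by
    refine le_antisymm (hupper _ (hatlas x)) ?_
    rw [← localVolume_restrict_source]
    exact Measure.restrict_mono le_rfl (hle x)
  -- By second countability, countably many chart domains cover `M`, and equality of measures can be
  -- checked on each of them.
  obtain ⟨t, ht, hcover⟩ := TopologicalSpace.countable_cover_nhds
    fun x : M ↦ chart_source_mem_nhds (EuclideanSpace ℝ (Fin n)) x
  have : Countable t := ht.to_subtype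
  rw [← Measure.restrict_univ (μ := localVolume g e),
    ← Measure.restrict_univ (μ := (riemannianVolume g).restrict e.source), ← hcover,
    Set.biUnion_eq_iUnion, Measure.restrict_iUnion_congr]
  intro x
  rw [Measure.restrict_comm (chartAt _ x.1).open_source.measurableSet, hchart,
    localVolume_restrict_comm hg (hatlas _) he]

end ChartVolume

/-! ### Regularity of the metric and of the metrics it induces. -/

section InducedMetric

variable {n k : ℕ} {Θ : Type*} [TopologicalSpace Θ] [ChartedSpace (EuclideanSpace ℝ (Fin n)) Θ]
  [IsManifold (𝓡 n) ∞ Θ] [RiemannianBundle (fun x : Θ ↦ TangentSpace (𝓡 n) x)]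

lemma metricTensor_bilinear (x : Θ) : ∃ B : LinearMap.BilinForm ℝ (EuclideanSpace ℝ (Fin n)),
    ∀ v w, (metricTensor n Θ).val x v w = B v w :=
  ⟨LinearMap.mk₂ ℝ (fun v w ↦ (metricTensor n Θ).val x v w)
    (fun u v w ↦ inner_add_left (E := TangentSpace (𝓡 n) x) u v w)
    (fun c v w ↦ real_inner_smul_left (F := TangentSpace (𝓡 n) x) v w c)
    (fun u v w ↦ inner_add_right (E := TangentSpace (𝓡 n) x) u v w)
    (fun c v w ↦ real_inner_smul_right (F := TangentSpace (𝓡 n) x) v w c), fun _ _ ↦ rfl⟩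

variable {S : Type*} [TopologicalSpace S] [ChartedSpace (EuclideanSpace ℝ (Fin k)) S]

/-- The differential of a map between manifolds, as a map between the model spaces. -/
def modelDeriv (k n : ℕ) {Θ S : Type*} [TopologicalSpace Θ]
    [ChartedSpace (EuclideanSpace ℝ (Fin n)) Θ] [TopologicalSpace S]
    [ChartedSpace (EuclideanSpace ℝ (Fin k)) S] (ι : S → Θ) (s : S) :
    EuclideanSpace ℝ (Fin k) →L[ℝ] EuclideanSpace ℝ (Fin n) :=
  mfderiv (𝓡 k) (𝓡 n) ι s

lemma inducedMetric_val (ι : S → Θ) (s : S) (v w : EuclideanSpace ℝ (Fin k)) :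
    (inducedMetric (n := n) ι).val s v w =
      (metricTensor n Θ).val (ι s) (modelDeriv k n ι s v) (modelDeriv k n ι s w) := rfl

lemma inducedMetric_bilinear (ι : S → Θ) (s : S) :
    ∃ B : LinearMap.BilinForm ℝ (EuclideanSpace ℝ (Fin k)),
      ∀ v w, (inducedMetric (n := n) ι).val s v w = B v w := by
  obtain ⟨B, hB⟩ := metricTensor_bilinear (n := n) (ι s)
  exact ⟨B.comp (modelDeriv k n ι s).toLinearMap (modelDeriv k n ι s).toLinearMap, fun v w ↦ hB _ _⟩

/-- Makes the regularity of the metric itself a special case of that of induced metrics. -/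
lemma metricTensor_eq_inducedMetric_id :
    metricTensor n Θ = inducedMetric (n := n) (k := n) (id : Θ → Θ) := by
  funext x v w
  simp only [inducedMetric, mfderiv_id]
  rfl

omit [IsManifold (𝓡 n) ∞ Θ] [RiemannianBundle (fun x : Θ ↦ TangentSpace (𝓡 n) x)] in
/-- The velocity of a chart curve in `Θ`. -/
lemma modelDeriv_comp_symm [IsManifold (𝓡 k) ∞ S] {ι : S → Θ} (hι : ContMDiff (𝓡 k) (𝓡 n) ∞ ι)
    {e : OpenPartialHomeomorph S (EuclideanSpace ℝ (Fin k))}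
    (he : e ∈ IsManifold.maximalAtlas (𝓡 k) ∞ S) {u : EuclideanSpace ℝ (Fin k)}
    (hu : u ∈ e.target) :
    modelDeriv k n (ι ∘ e.symm) u = (modelDeriv k n ι (e.symm u)).comp (frameMap e u) := by
  unfold modelDeriv
  rw [mfderiv_comp u ((hι _).mdifferentiableAt (by simp))
    ((contMDiffAt_symm_of_mem_maximalAtlas he hu).mdifferentiableAt (by simp))]
  rfl

/-- The tangent map of `φ` is continuous into the tangent bundle, and the inner product of two
continuous fields along `φ` is continuous. -/
lemma continuousOn_metricTensor_modelDeriv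
    [IsContMDiffRiemannianBundle (𝓡 n) ∞ (EuclideanSpace ℝ (Fin n))
      (fun x : Θ ↦ TangentSpace (𝓡 n) x)]
    {φ : EuclideanSpace ℝ (Fin k) → Θ} {U : Set (EuclideanSpace ℝ (Fin k))} (hU : IsOpen U)
    (hφ : ContMDiffOn (𝓡 k) (𝓡 n) ∞ φ U) (v w : EuclideanSpace ℝ (Fin k)) :
    ContinuousOn
      (fun u ↦ (metricTensor n Θ).val (φ u) (modelDeriv k n φ u v) (modelDeriv k n φ u w)) U := by
  have : IsManifold (𝓡 n) 1 Θ := IsManifold.of_le (n := ∞) (by simp)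
  have key : ∀ v : EuclideanSpace ℝ (Fin k), ContinuousOn
      (fun u ↦ (⟨φ u, mfderiv (𝓡 k) (𝓡 n) φ u v⟩ :
        TotalSpace (EuclideanSpace ℝ (Fin n)) (fun x : Θ ↦ TangentSpace (𝓡 n) x))) U := by
    intro v
    have h1 := hφ.continuousOn_tangentMapWithin (by simp) hU.uniqueMDiffOn
    have h2 : Continuous fun u : EuclideanSpace ℝ (Fin k) ↦
        (tangentBundleModelSpaceHomeomorph (𝓡 k)).symm (u, v) :=
      (tangentBundleModelSpaceHomeomorph (𝓡 k)).symm.continuous.comp (by fun_prop)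
    refine (h1.comp h2.continuousOn fun u hu ↦ hu).congr fun u hu ↦ ?_
    simp only [Function.comp, tangentMapWithin, tangentBundleModelSpaceHomeomorph_coe_symm]
    change _ = (⟨φ u, mfderivWithin (𝓡 k) (𝓡 n) φ U u v⟩ : TotalSpace _ _)
    rw [mfderivWithin_of_isOpen hU hu]
  have h3 : IsContinuousRiemannianBundle (EuclideanSpace ℝ (Fin n))
      (fun x : Θ ↦ TangentSpace (𝓡 n) x) := by
    obtain ⟨g, hg, h⟩ := IsContMDiffRiemannianBundle.exists_contMDiff (IB := 𝓡 n) (n := ∞)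
      (F := EuclideanSpace ℝ (Fin n)) (E := fun x : Θ ↦ TangentSpace (𝓡 n) x)
    exact ⟨g, hg.continuous, h⟩
  exact ContinuousOn.inner_bundle (key v) (key w)

variable [IsContMDiffRiemannianBundle (𝓡 n) ∞ (EuclideanSpace ℝ (Fin n))
      (fun x : Θ ↦ TangentSpace (𝓡 n) x)]

theorem inducedMetric_isRegular [IsManifold (𝓡 k) ∞ S] {ι : S → Θ}
    (hι : ContMDiff (𝓡 k) (𝓡 n) ∞ ι) : (inducedMetric (n := n) (k := k) ι).IsRegular where
  bilinear := inducedMetric_bilinear ι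
  continuousOn e he := by
    refine continuousOn_pi.2 fun i ↦ continuousOn_pi.2 fun j ↦ ?_
    refine (continuousOn_metricTensor_modelDeriv (n := n) e.open_target
      (hι.comp_contMDiffOn (contMDiffOn_symm_of_mem_maximalAtlas he))
      (EuclideanSpace.single i 1) (EuclideanSpace.single j 1)).congr fun u hu ↦ ?_
    simp only [modelDeriv_comp_symm hι he hu]
    rfl

theorem metricTensor_isRegular : (metricTensor n Θ).IsRegular := by
  rw [metricTensor_eq_inducedMetric_id]
  exact inducedMetric_isRegular contMDiff_id

omit [IsManifold (𝓡 n) ∞ Θ] [RiemannianBundle (fun x : Θ ↦ TangentSpace (𝓡 n) x)]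
  [IsContMDiffRiemannianBundle (𝓡 n) ∞ (EuclideanSpace ℝ (Fin n))
    (fun x : Θ ↦ TangentSpace (𝓡 n) x)] in
lemma frameMap_injective {e : OpenPartialHomeomorph Θ (EuclideanSpace ℝ (Fin n))}
    (he : e ∈ IsManifold.maximalAtlas (𝓡 n) ∞ Θ) {u : EuclideanSpace ℝ (Fin n)}
    (hu : u ∈ e.target) : Function.Injective (frameMap e u) := by
  have h1 : MDifferentiableAt (𝓡 n) (𝓡 n) e.symm u :=
    (contMDiffAt_symm_of_mem_maximalAtlas he hu).mdifferentiableAt (by simp)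
  have h2 : MDifferentiableAt (𝓡 n) (𝓡 n) e (e.symm u) :=
    (contMDiffAt_of_mem_maximalAtlas he (e.map_target hu)).mdifferentiableAt (by simp)
  have h3 := mfderiv_comp u h2 h1
  have h4 : e ∘ e.symm =ᶠ[𝓝 u] id := by
    filter_upwards [e.open_target.mem_nhds hu] with v hv using e.right_inv hv
  rw [h4.mfderiv_eq, mfderiv_id] at h3
  exact Function.LeftInverse.injective (g := mfderiv (𝓡 n) (𝓡 n) e (e.symm u))
    fun v ↦ (DFunLike.congr_fun h3 v).symm

end InducedMetric

/-! ### Gram determinants and the splitting of coordinates. -/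

section LinearAlgebra

/-- Gram determinants of a frame `(a, b)` and of the vectors `N` that are dual to `a` and
orthogonal to `b`: this is the complementary minor formula for the inverse of a Gram matrix. -/
theorem det_gram_sumElim_mul_det_gram {ι κ V : Type*} [Fintype ι] [Fintype κ] [DecidableEq ι]
    [DecidableEq κ] [NormedAddCommGroup V] [InnerProductSpace ℝ V] {a N : ι → V} {b : κ → V}
    (hspan : ∀ v, v ∈ Submodule.span ℝ (Set.range (Sum.elim a b)))
    (ha : ∀ i j, inner ℝ (N i) (a j) = if i = j then 1 else 0)
    (hb : ∀ i j, inner ℝ (N i) (b j) = 0) :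
    (Matrix.gram ℝ (Sum.elim a b)).det * (Matrix.gram ℝ N).det = (Matrix.gram ℝ b).det := by
  choose c hc using fun i ↦ (Submodule.mem_span_range_iff_exists_fun ℝ).1 (hspan (N i))
  set C : Matrix ι ι ℝ := Matrix.of fun i l ↦ c i (Sum.inl l)
  set D : Matrix ι κ ℝ := Matrix.of fun i l ↦ c i (Sum.inr l)
  have hN : ∀ i v, inner ℝ (N i) v =
      ∑ l, c i (Sum.inl l) * inner ℝ (a l) v + ∑ l, c i (Sum.inr l) * inner ℝ (b l) v := by
    intro i v
    conv_lhs => rw [← hc i, Fintype.sum_sum_type, inner_add_left, sum_inner, sum_inner]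
    simp only [Sum.elim_inl, Sum.elim_inr, real_inner_smul_left]
  -- Pairing the expansion of `N i` with `N j` keeps only the coefficient of `a j`.
  have hG : Matrix.gram ℝ N = C := by
    ext i j
    rw [Matrix.gram_apply, hN]
    simp [real_inner_comm (N j), ha, hb, C]
  -- The upper rows of the left factor are the coordinates of the `N i`; their products with the
  -- Gram matrix are the pairings prescribed by `ha` and `hb`. Determinants of the two block
  -- triangular matrices give the formula.
  have hmul : Matrix.fromBlocks C D 0 1 * Matrix.gram ℝ (Sum.elim a b) =
      Matrix.fromBlocks 1 0 (Matrix.of fun i j ↦ inner ℝ (b i) (a j)) (Matrix.gram ℝ b) := by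
    ext (i | i) (j | j)
    · rw [Matrix.mul_apply, Fintype.sum_sum_type]
      simp only [Matrix.fromBlocks_apply₁₁, Matrix.fromBlocks_apply₁₂, Matrix.gram_apply,
        Sum.elim_inl, Sum.elim_inr, Matrix.one_apply, ← ha i j, hN i, C, D, Matrix.of_apply]
    · rw [Matrix.mul_apply, Fintype.sum_sum_type]
      simp only [Matrix.fromBlocks_apply₁₁, Matrix.fromBlocks_apply₁₂, Matrix.gram_apply,
        Sum.elim_inl, Sum.elim_inr, Matrix.zero_apply, ← hb i j, hN i, C, D, Matrix.of_apply]
    · simp [Matrix.mul_apply, Matrix.one_apply]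
    · simp [Matrix.mul_apply, Matrix.one_apply]
  have h := congrArg Matrix.det hmul
  rw [Matrix.det_mul, Matrix.det_fromBlocks_zero₂₁, Matrix.det_fromBlocks_zero₁₂] at h
  rw [hG, mul_comm]
  simpa using h

variable {m k n : ℕ}

/-- The identification of `ℝᵐ × ℝᵏ` with `ℝⁿ` along a splitting of the coordinates. -/
def splitEquiv (ε : Fin m ⊕ Fin k ≃ Fin n) :
    (EuclideanSpace ℝ (Fin m) × EuclideanSpace ℝ (Fin k)) ≃L[ℝ] EuclideanSpace ℝ (Fin n) :=
  ((WithLp.prodContinuousLinearEquiv 2 ℝ (EuclideanSpace ℝ (Fin m))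
    (EuclideanSpace ℝ (Fin k))).symm.trans
    (PiLp.sumPiLpEquivProdLpPiLp (𝕜 := ℝ) 2
      (fun _ : Fin m ⊕ Fin k ↦ ℝ)).symm.toContinuousLinearEquiv).trans
    (LinearIsometryEquiv.piLpCongrLeft 2 ℝ ℝ ε).toContinuousLinearEquiv

/-- The product carries the sup norm, so this is no isometry. Its first factor passes to the `ℓ²`
product and preserves volume; the other two are linear isometries. -/
lemma splitEquiv_measurePreserving (ε : Fin m ⊕ Fin k ≃ Fin n) :
    MeasurePreserving (splitEquiv ε) := by
  have h1 := WithLp.volume_preserving_toLp (EuclideanSpace ℝ (Fin m)) (EuclideanSpace ℝ (Fin k))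
  have h2 := (PiLp.sumPiLpEquivProdLpPiLp (𝕜 := ℝ) 2
      (fun _ : Fin m ⊕ Fin k ↦ ℝ)).symm.measurePreserving
  exact ((LinearIsometryEquiv.piLpCongrLeft 2 ℝ ℝ ε).measurePreserving.comp h2).comp h1

lemma splitEquiv_apply_inl (ε : Fin m ⊕ Fin k ≃ Fin n) (x) (i : Fin m) :
    splitEquiv ε x (ε (Sum.inl i)) = x.1 i := by
  simp only [splitEquiv, ContinuousLinearEquiv.trans_apply,
    LinearIsometryEquiv.coe_toContinuousLinearEquiv, LinearIsometryEquiv.piLpCongrLeft_apply,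
    Equiv.piCongrLeft'_apply, Equiv.symm_apply_apply]
  rfl

lemma splitEquiv_apply_inr (ε : Fin m ⊕ Fin k ≃ Fin n) (x) (i : Fin k) :
    splitEquiv ε x (ε (Sum.inr i)) = x.2 i := by
  simp only [splitEquiv, ContinuousLinearEquiv.trans_apply,
    LinearIsometryEquiv.coe_toContinuousLinearEquiv, LinearIsometryEquiv.piLpCongrLeft_apply,
    Equiv.piCongrLeft'_apply, Equiv.symm_apply_apply]
  rfl

lemma splitEquiv_single_left (ε : Fin m ⊕ Fin k ≃ Fin n) (i : Fin m) :
    splitEquiv ε (EuclideanSpace.single i 1, 0) = EuclideanSpace.single (ε (Sum.inl i)) 1 := by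
  ext j
  obtain ⟨j | j, rfl⟩ := ε.surjective j
  · rw [splitEquiv_apply_inl]; simp
  · rw [splitEquiv_apply_inr]; simp

lemma splitEquiv_single_right (ε : Fin m ⊕ Fin k ≃ Fin n) (i : Fin k) :
    splitEquiv ε (0, EuclideanSpace.single i 1) = EuclideanSpace.single (ε (Sum.inr i)) 1 := by
  ext j
  obtain ⟨j | j, rfl⟩ := ε.surjective j
  · rw [splitEquiv_apply_inl]; simp
  · rw [splitEquiv_apply_inr]; simp

end LinearAlgebra

/-! ### The limit of mollified integrals in a product of Euclidean spaces. -/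

section Mollifier

variable {m k : ℕ}

/-- By Fubini only the fibre integral `K y = ∫ F (y, u) du` matters; it is continuous and bounded.
The substitution `y ↦ ε y` turns the integral into `∫ K (ε y) η y dy`, dominated by a multiple of
`|η|`. Continuity is needed of `K` alone, not of `η`. -/
theorem tendsto_integral_mul_mollifier
    {F : EuclideanSpace ℝ (Fin m) × EuclideanSpace ℝ (Fin k) → ℝ} (hF : Continuous F)
    (hFc : HasCompactSupport F) {η : EuclideanSpace ℝ (Fin m) → ℝ} (hη : Measurable η)
    (hηb : ∃ C, ∀ y, |η y| ≤ C) (hηc : HasCompactSupport η) (hη1 : ∫ y, η y = 1) :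
    Tendsto (fun ε : ℝ ↦ ∫ x, F x * ((ε ^ m)⁻¹ * η (ε⁻¹ • x.1))) (𝓝[>] 0)
      (𝓝 (∫ u, F (0, u))) := by
  obtain ⟨C, hC⟩ := hηb
  -- One compact set contains the supports of all fibres, giving continuity of `K` and a uniform
  -- bound.
  set c : Set (EuclideanSpace ℝ (Fin k)) := Prod.snd '' tsupport F
  have hc : IsCompact c := hFc.isCompact.image continuous_snd
  set K : EuclideanSpace ℝ (Fin m) → ℝ := fun y ↦ ∫ u, F (y, u) with hKdef
  have hKc : ∀ y, K y = ∫ u in c, F (y, u) := fun y ↦ by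
    refine (setIntegral_eq_integral_of_forall_compl_eq_zero fun u hu ↦ ?_).symm
    by_contra h
    exact hu ⟨(y, u), subset_tsupport _ h, rfl⟩
  have hK : Continuous K := by
    have := continuous_parametric_integral_of_continuous (μ := volume)
      (f := fun y u ↦ F (y, u)) (by simpa [Function.uncurry_def] using hF) hc
    simpa only [← hKc] using this
  obtain ⟨M, hM⟩ := hFc.exists_bound_of_continuous hF
  have hKb : ∀ y, ‖K y‖ ≤ M * volume.real c := fun y ↦ by
    rw [hKc]
    exact norm_setIntegral_le_of_norm_le_const hc.measure_lt_top fun u _ ↦ hM _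
  have hηi : Integrable η := by
    refine (Measure.integrableOn_of_bounded (M := C) hηc.isCompact.measure_lt_top.ne
      hη.aestronglyMeasurable (Eventually.of_forall hC)).integrable_of_forall_notMem_eq_zero
      fun x hx ↦ image_eq_zero_of_notMem_tsupport hx
  have hlim : Tendsto (fun ε : ℝ ↦ ∫ y, K (ε • y) * η y) (𝓝[>] 0) (𝓝 (∫ u, F (0, u))) := by
    have : ∫ u, F (0, u) = ∫ y, K 0 * η y := by
      rw [integral_const_mul, hη1, mul_one]
    rw [this]
    refine tendsto_integral_filter_of_dominated_convergence (fun y ↦ (M * volume.real c) * ‖η y‖)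
      (Eventually.of_forall fun ε ↦ ?_) (Eventually.of_forall fun ε ↦ Eventually.of_forall
      fun y ↦ ?_) (hηi.norm.const_mul _) (Eventually.of_forall fun y ↦ ?_)
    · exact ((hK.comp (continuous_const_smul ε)).measurable.mul hη).aestronglyMeasurable
    · rw [norm_mul]
      exact mul_le_mul_of_nonneg_right (hKb _) (norm_nonneg _)
    · refine Tendsto.mul_const _ (((hK.comp (by fun_prop : Continuous fun ε : ℝ ↦ ε • y)).tendsto'
        0 _ (by simp)).mono_left nhdsWithin_le_nhds)
  refine hlim.congr' ?_
  filter_upwards [self_mem_nhdsWithin] with ε hε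
  have hε : 0 < ε := hε
  have hint : Integrable (fun x : EuclideanSpace ℝ (Fin m) × EuclideanSpace ℝ (Fin k) ↦
      F x * ((ε ^ m)⁻¹ * η (ε⁻¹ • x.1))) (volume.prod volume) := by
    refine (hF.integrable_of_hasCompactSupport hFc).mul_bdd (c := (ε ^ m)⁻¹ * C) ?_ ?_
    · exact (measurable_const.mul (hη.comp (by fun_prop))).aestronglyMeasurable
    · refine Eventually.of_forall fun x ↦ ?_
      rw [norm_mul, Real.norm_of_nonneg (by positivity)]
      exact mul_le_mul_of_nonneg_left (hC _) (by positivity)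
  rw [Measure.volume_eq_prod, integral_prod _ hint]
  have h1 : ∀ y, ∫ u, F (y, u) * ((ε ^ m)⁻¹ * η (ε⁻¹ • y)) = K y * ((ε ^ m)⁻¹ * η (ε⁻¹ • y)) :=
    fun y ↦ integral_mul_const _ _
  simp only [h1]
  -- The Jacobian of the dilation supplies a second factor `(ε ^ m)⁻¹`, which cancels the one in the
  -- mollifier.
  have h2 := Measure.integral_comp_smul volume (fun y ↦ K y * ((ε ^ m)⁻¹ * η (ε⁻¹ • y))) ε
  have h3 : ∀ y : EuclideanSpace ℝ (Fin m), ε⁻¹ • ε • y = y := fun y ↦ inv_smul_smul₀ hε.ne' y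
  simp only [h3, finrank_euclideanSpace_fin, abs_of_pos (inv_pos.2 (pow_pos hε m)),
    smul_eq_mul] at h2
  have h4 : ∀ y, K (ε • y) * ((ε ^ m)⁻¹ * η y) = (ε ^ m)⁻¹ * (K (ε • y) * η y) :=
    fun y ↦ by ring
  simp only [h4, integral_const_mul] at h2
  have h5 := mul_left_cancel₀ (inv_pos.2 (pow_pos hε m)).ne' h2
  simpa only [integral_const_mul] using h5

end Mollifier

/-! ### Charts adapted to the slice. -/

section AdaptedChart

variable {n m k : ℕ} {Θ : Type*} [TopologicalSpace Θ] [ChartedSpace (EuclideanSpace ℝ (Fin n)) Θ]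
  [IsManifold (𝓡 n) ∞ Θ] {χ : Θ → EuclideanSpace ℝ (Fin m)}
  [ChartedSpace (EuclideanSpace ℝ (Fin k)) (χ ⁻¹' {0})]

omit [IsManifold (𝓡 n) ∞ Θ] in
/-- An immersion chart, with the linear equivalence written as a splitting of `ℝⁿ`. -/
lemma exists_slice_charts
    (hS : Manifold.IsSmoothEmbedding (𝓡 k) (𝓡 n) ∞ (Subtype.val : χ ⁻¹' {0} → Θ))
    (s₀ : χ ⁻¹' {0}) :
    ∃ (c : OpenPartialHomeomorph Θ (EuclideanSpace ℝ (Fin n)))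
      (d : OpenPartialHomeomorph (χ ⁻¹' {0}) (EuclideanSpace ℝ (Fin k)))
      (i : EuclideanSpace ℝ (Fin k) →L[ℝ] EuclideanSpace ℝ (Fin n))
      (r : EuclideanSpace ℝ (Fin n) →L[ℝ] EuclideanSpace ℝ (Fin k)),
      c ∈ IsManifold.maximalAtlas (𝓡 n) ∞ Θ ∧
      d ∈ IsManifold.maximalAtlas (𝓡 k) ∞ (χ ⁻¹' {0}) ∧ s₀ ∈ d.source ∧
      (∀ s ∈ d.source, (s : Θ) ∈ c.source ∧ c s = i (d s)) ∧ ∀ w, r (i w) = w := by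
  have h := hS.isImmersion.isImmersionAt s₀
  refine ⟨h.codChart, h.domChart,
    h.equiv.toContinuousLinearMap.comp (ContinuousLinearMap.inl ℝ _ _),
    (ContinuousLinearMap.fst ℝ _ _).comp h.equiv.symm.toContinuousLinearMap,
    h.codChart_mem_maximalAtlas, h.domChart_mem_maximalAtlas, h.mem_domChart_source,
    fun s hs ↦ ⟨h.source_subset_preimage_source hs, ?_⟩, fun w ↦ by simp⟩
  have hmem : h.domChart s ∈ (h.domChart.extend (𝓡 k)).target := by
    simpa using h.domChart.map_source hs
  have := h.writtenInCharts hmem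
  simpa [h.domChart.left_inv hs] using this

omit [IsManifold (𝓡 n) ∞ Θ] in
lemma fderiv_comp_symm_surjective (hχ : ContMDiff (𝓡 n) (𝓡 m) ∞ χ)
    (hreg : ∀ θ, χ θ = 0 → Function.Surjective (mfderiv (𝓡 n) (𝓡 m) χ θ))
    {c : OpenPartialHomeomorph Θ (EuclideanSpace ℝ (Fin n))}
    (hc : c ∈ IsManifold.maximalAtlas (𝓡 n) ∞ Θ) {θ : Θ} (hθ : θ ∈ c.source) (h0 : χ θ = 0) :
    Function.Surjective (fderiv ℝ (χ ∘ c.symm) (c θ)) := by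
  have h1 : MDifferentiableAt (𝓡 n) (𝓡 n) c.symm (c θ) :=
    (contMDiffAt_symm_of_mem_maximalAtlas hc (c.map_source hθ)).mdifferentiableAt (by simp)
  have h2 : MDifferentiableAt (𝓡 n) (𝓡 m) χ (c.symm (c θ)) := (hχ _).mdifferentiableAt (by simp)
  rw [← mfderiv_eq_fderiv, mfderiv_comp _ h2 h1]
  have h3 : Function.Surjective (frameMap c (c θ)) :=
    LinearMap.surjective_of_injective (f := (frameMap c (c θ)).toLinearMap)
      (frameMap_injective hc (c.map_source hθ))
  have h4 := hreg (c.symm (c θ)) (by rw [c.left_inv hθ, h0])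
  exact h4.comp h3

-- In these charts the slice is parametrized by the linear map `i`, along which `χ` vanishes
-- identically; differentiating gives the claim.
omit [ChartedSpace (EuclideanSpace ℝ (Fin n)) Θ] [IsManifold (𝓡 n) ∞ Θ]
  [ChartedSpace (EuclideanSpace ℝ (Fin k)) (χ ⁻¹' {0})] in
lemma fderiv_comp_symm_apply_tangent
    {c : OpenPartialHomeomorph Θ (EuclideanSpace ℝ (Fin n))}
    {d : OpenPartialHomeomorph (χ ⁻¹' {0}) (EuclideanSpace ℝ (Fin k))}
    {i : EuclideanSpace ℝ (Fin k) →L[ℝ] EuclideanSpace ℝ (Fin n)} {s : χ ⁻¹' {0}}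
    (hs : s ∈ d.source) (hcd : ∀ s ∈ d.source, (s : Θ) ∈ c.source ∧ c s = i (d s))
    (hd : DifferentiableAt ℝ (χ ∘ c.symm) (c s)) (w : EuclideanSpace ℝ (Fin k)) :
    fderiv ℝ (χ ∘ c.symm) (c s) (i w) = 0 := by
  have h0 : (χ ∘ c.symm) ∘ i =ᶠ[𝓝 (d s)] fun _ ↦ 0 := by
    filter_upwards [d.open_target.mem_nhds (d.map_source hs)] with u hu
    have h1 := hcd (d.symm u) (d.map_target hu)
    rw [d.right_inv hu] at h1
    simp only [Function.comp]
    rw [← h1.2, c.left_inv h1.1]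
    exact (d.symm u).2
  have h2 : DifferentiableAt ℝ (χ ∘ c.symm) (i (d s)) := by rwa [← (hcd s hs).2]
  have h3 := h2.hasFDerivAt.comp (d s) i.hasFDerivAt
  have h4 := h3.unique
    ((hasFDerivAt_const (0 : EuclideanSpace ℝ (Fin m)) (d s)).congr_of_eventuallyEq h0)
  rw [(hcd s hs).2]
  exact DFunLike.congr_fun h4 w

omit [IsManifold (𝓡 n) ∞ Θ] in
lemma contDiffAt_comp_symm (hχ : ContMDiff (𝓡 n) (𝓡 m) ∞ χ)
    {c : OpenPartialHomeomorph Θ (EuclideanSpace ℝ (Fin n))}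
    (hc : c ∈ IsManifold.maximalAtlas (𝓡 n) ∞ Θ) {x : EuclideanSpace ℝ (Fin n)}
    (hx : x ∈ c.target) : ContDiffAt ℝ ∞ (χ ∘ c.symm) x :=
  ((hχ _).comp x (contMDiffAt_symm_of_mem_maximalAtlas hc hx)).contDiffAt

omit [IsManifold (𝓡 n) ∞ Θ] in
/-- The slice has dimension at most `n - m`. -/
lemma add_le_of_slice (hχ : ContMDiff (𝓡 n) (𝓡 m) ∞ χ)
    (hreg : ∀ θ, χ θ = 0 → Function.Surjective (mfderiv (𝓡 n) (𝓡 m) χ θ))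
    (hS : Manifold.IsSmoothEmbedding (𝓡 k) (𝓡 n) ∞ (Subtype.val : χ ⁻¹' {0} → Θ))
    (s₀ : χ ⁻¹' {0}) : m + k ≤ n := by
  obtain ⟨c, d, i, r, hc, hd, hs₀, hcd, hr⟩ := exists_slice_charts hS s₀
  obtain ⟨hsc, -⟩ := hcd s₀ hs₀
  set A := fderiv ℝ (χ ∘ c.symm) (c s₀)
  have hA : Function.Surjective A := fderiv_comp_symm_surjective hχ hreg hc hsc s₀.2
  have hAi : ∀ w, A (i w) = 0 := fderiv_comp_symm_apply_tangent hs₀ hcd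
    ((contDiffAt_comp_symm hχ hc (c.map_source hsc)).differentiableAt (by simp))
  have h1 := LinearMap.finrank_range_add_finrank_ker A.toLinearMap
  have h2 : LinearMap.range i.toLinearMap ≤ LinearMap.ker A.toLinearMap := by
    rintro _ ⟨w, rfl⟩; exact hAi w
  have h3 := Submodule.finrank_mono h2
  rw [LinearMap.finrank_range_of_inj
    (Function.LeftInverse.injective hr : Function.Injective i)] at h3
  rw [LinearMap.range_eq_top.2 hA] at h1
  simp at h1 h3
  omega

/-- The data of an adapted chart: its first `m` coordinates are `χ`, and its last `k`
coordinates restrict to a chart of the slice. -/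
structure IsAdapted (ε : Fin m ⊕ Fin k ≃ Fin n)
    (e : OpenPartialHomeomorph Θ (EuclideanSpace ℝ (Fin n)))
    (d : OpenPartialHomeomorph (χ ⁻¹' {0}) (EuclideanSpace ℝ (Fin k))) : Prop where
  mem_atlas : e ∈ IsManifold.maximalAtlas (𝓡 n) ∞ Θ
  mem_slice_atlas : d ∈ IsManifold.maximalAtlas (𝓡 k) ∞ (χ ⁻¹' {0})
  fst_eq : ∀ θ ∈ e.source, ((splitEquiv ε).symm (e θ)).1 = χ θ
  slice : ∀ s : χ ⁻¹' {0}, (s : Θ) ∈ e.source → s ∈ d.source ∧ e s = splitEquiv ε (0, d s)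

/-- Around every point of the slice there is a chart of `Θ` whose first `m` coordinates are `χ`
and whose last `k` coordinates restrict to a chart of the slice. -/
theorem exists_adapted_chart (hχ : ContMDiff (𝓡 n) (𝓡 m) ∞ χ)
    (hreg : ∀ θ, χ θ = 0 → Function.Surjective (mfderiv (𝓡 n) (𝓡 m) χ θ))
    (hS : Manifold.IsSmoothEmbedding (𝓡 k) (𝓡 n) ∞ (Subtype.val : χ ⁻¹' {0} → Θ))
    (ε : Fin m ⊕ Fin k ≃ Fin n) (s₀ : χ ⁻¹' {0}) :
    ∃ (e : OpenPartialHomeomorph Θ (EuclideanSpace ℝ (Fin n)))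
      (d : OpenPartialHomeomorph (χ ⁻¹' {0}) (EuclideanSpace ℝ (Fin k))),
      IsAdapted ε e d ∧ (s₀ : Θ) ∈ e.source := by
  obtain ⟨c, d, i, r, hc, hd, hs₀, hcd, hr⟩ := exists_slice_charts hS s₀
  obtain ⟨hsc, -⟩ := hcd s₀ hs₀
  have hx₀ := c.map_source hsc
  set A := fderiv ℝ (χ ∘ c.symm) (c s₀) with hAdef
  have hdiff := (contDiffAt_comp_symm hχ hc hx₀).differentiableAt (by simp)
  have hA : Function.Surjective A := fderiv_comp_symm_surjective hχ hreg hc hsc s₀.2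
  have hAi : ∀ w, A (i w) = 0 := fderiv_comp_symm_apply_tangent hs₀ hcd hdiff
  have hnmk : m + k = n := by simpa using Fintype.card_congr ε
  -- The inclusion is an equality by dimension: both spaces have dimension `k = n - m`.
  have hker : LinearMap.range i.toLinearMap = LinearMap.ker A.toLinearMap := by
    refine Submodule.eq_of_le_of_finrank_eq (by rintro _ ⟨w, rfl⟩; exact hAi w) ?_
    have h1 := LinearMap.finrank_range_add_finrank_ker A.toLinearMap
    rw [LinearMap.finrank_range_of_inj
      (Function.LeftInverse.injective hr : Function.Injective i)]
    rw [LinearMap.range_eq_top.2 hA] at h1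
    simp at h1 ⊢
    omega
  -- `r` is a linear left inverse of the slice parametrization, so it is injective on `ker A`, and
  -- `(A, r)` is injective.
  set Ψ : EuclideanSpace ℝ (Fin n) → EuclideanSpace ℝ (Fin n) :=
    fun x ↦ splitEquiv ε (χ (c.symm x), r x) with hΨ
  set D : EuclideanSpace ℝ (Fin n) →L[ℝ] EuclideanSpace ℝ (Fin n) :=
    (splitEquiv ε : _ →L[ℝ] _).comp (A.prod r) with hD
  have hDinj : Function.Injective D := by
    refine (injective_iff_map_eq_zero D).2 fun v hv ↦ ?_
    have h1 : (A v, r v) = 0 := (splitEquiv ε).injective (by simpa [hD] using hv)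
    obtain ⟨w, rfl⟩ : v ∈ LinearMap.range i.toLinearMap := by
      rw [hker]; exact (Prod.ext_iff.1 h1).1
    have h2 : w = 0 := by simpa [hr] using (Prod.ext_iff.1 h1).2
    simp [h2]
  set D' : EuclideanSpace ℝ (Fin n) ≃L[ℝ] EuclideanSpace ℝ (Fin n) :=
    (LinearEquiv.ofInjectiveEndo D.toLinearMap hDinj).toContinuousLinearEquiv with hD'
  have hDD' : (D' : EuclideanSpace ℝ (Fin n) →L[ℝ] EuclideanSpace ℝ (Fin n)) = D := by
    ext v; rfl
  have hΨsmooth : ∀ x ∈ c.target, ContDiffAt ℝ ∞ Ψ x := fun x hx ↦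
    (splitEquiv ε).contDiff.contDiffAt.comp x
      ((contDiffAt_comp_symm hχ hc hx).prodMk r.contDiff.contDiffAt)
  have hΨderiv : HasFDerivAt Ψ (D' : _ →L[ℝ] _) (c s₀) := by
    rw [hDD']
    exact (splitEquiv ε).hasFDerivAt.comp (c (s₀ : Θ)) (hdiff.hasFDerivAt.prodMk r.hasFDerivAt)
  set ψ := (hΨsmooth _ hx₀).toOpenPartialHomeomorph Ψ hΨderiv (by simp) with hψ
  have hψΨ : ∀ x, ψ x = Ψ x := fun x ↦ rfl
  -- Smoothness of the inverse is needed on the whole chart, so the domain is cut down to the open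
  -- set where the derivative of `Ψ` is invertible.
  set N : Set (EuclideanSpace ℝ (Fin n)) := {x | x ∈ c.target ∧ fderiv ℝ Ψ x ∈
    Set.range ((↑) : (EuclideanSpace ℝ (Fin n) ≃L[ℝ] EuclideanSpace ℝ (Fin n)) →
      EuclideanSpace ℝ (Fin n) →L[ℝ] EuclideanSpace ℝ (Fin n))} with hN
  have hNopen : IsOpen N := by
    have hcont : ContinuousOn (fderiv ℝ Ψ) c.target := fun x hx ↦
      ((hΨsmooth x hx).continuousAt_fderiv (by simp)).continuousWithinAt
    exact hcont.isOpen_inter_preimage c.open_target (ContinuousLinearEquiv.isOpen)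
  -- Restricting to `W` keeps every slice point of the new chart inside `d.source`; this excludes
  -- other sheets of the slice that return near `s₀`.
  obtain ⟨W, hW, hWd⟩ := isOpen_induced_iff.1 d.open_source
  set e := ((c ≫ₕ ψ).restr W).restr (c.source ∩ c ⁻¹' N) with he
  have hNs : IsOpen (c.source ∩ c ⁻¹' N) := c.isOpen_inter_preimage hNopen
  have he_source : ∀ θ, θ ∈ e.source ↔ (θ ∈ c.source ∧ c θ ∈ ψ.source) ∧ θ ∈ W ∧ c θ ∈ N := by
    intro θ
    simp only [he, OpenPartialHomeomorph.restr_source, OpenPartialHomeomorph.trans_source,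
      hNs.interior_eq, hW.interior_eq, Set.mem_inter_iff, Set.mem_preimage]
    tauto
  have he_apply : ∀ θ, e θ = Ψ (c θ) := fun θ ↦ rfl
  refine ⟨e, d, ⟨?_, hd, ?_, ?_⟩, ?_⟩
  · refine e.mem_maximalAtlas_of_contMDiffOn ?_ ?_
    · intro θ hθ
      obtain ⟨⟨h1, -⟩, -⟩ := (he_source θ).1 hθ
      exact ((hΨsmooth _ (c.map_source h1)).contMDiffAt.comp θ
        (contMDiffAt_of_mem_maximalAtlas hc h1)).contMDiffWithinAt
    · intro x hx
      have hθ := (he_source _).1 (e.map_target hx)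
      set θ := e.symm x with hθdef
      obtain ⟨⟨h1, h2⟩, -, -, L, hL⟩ := hθ
      have hxt : x ∈ ψ.target := by
        rw [← e.right_inv hx]
        exact ψ.map_source h2
      have hxs : ψ.symm x = c θ := by
        rw [← ψ.left_inv h2]
        congr 1
        exact (e.right_inv hx).symm
      have h3 : ContDiffAt ℝ ∞ ψ.symm x := by
        refine ψ.contDiffAt_symm (f₀' := L) hxt ?_ ?_
        · rw [hxs, hL]
          exact ((hΨsmooth _ (c.map_source h1)).differentiableAt (by simp)).hasFDerivAt
        · rw [hxs]
          exact hΨsmooth _ (c.map_source h1)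
      refine ContMDiffAt.contMDiffWithinAt ?_
      have h4 : ContMDiffAt (𝓡 n) (𝓡 n) ∞ (c.symm ∘ ψ.symm) x := by
        refine ContMDiffAt.comp x ?_ h3.contMDiffAt
        rw [hxs]
        exact contMDiffAt_symm_of_mem_maximalAtlas hc (c.map_source h1)
      exact h4
  · intro θ hθ
    obtain ⟨⟨h1, -⟩, -⟩ := (he_source θ).1 hθ
    rw [he_apply, hΨ]
    simp [c.left_inv h1]
  · intro s hs
    obtain ⟨⟨h1, -⟩, h2, -⟩ := (he_source _).1 hs
    have h3 : s ∈ d.source := by rw [← hWd]; exact h2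
    refine ⟨h3, ?_⟩
    have h4 : χ s = 0 := s.2
    rw [he_apply, hΨ]
    simp only [c.left_inv h1, h4]
    rw [(hcd s h3).2, hr]
  · refine (he_source _).2 ⟨⟨hsc, ?_⟩, ?_, hx₀, ⟨D', hΨderiv.fderiv.symm⟩⟩
    · exact (hΨsmooth _ hx₀).mem_toOpenPartialHomeomorph_source hΨderiv (by simp)
    · have : s₀ ∈ Subtype.val ⁻¹' W := hWd ▸ hs₀
      exact this

end AdaptedChart

/-! ### Integration against the Riemannian volume. -/

section VolumeIntegral

variable {n : ℕ} {M : Type*} [TopologicalSpace M] [ChartedSpace (EuclideanSpace ℝ (Fin n)) M]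

lemma chartDensity_nonneg (g : TensorField n M)
    (e : OpenPartialHomeomorph M (EuclideanSpace ℝ (Fin n))) (u : EuclideanSpace ℝ (Fin n)) :
    0 ≤ chartDensity g e u := Real.sqrt_nonneg _

lemma TensorField.IsRegular.continuousOn_chartDensity {g : TensorField n M} (hg : g.IsRegular)
    {e : OpenPartialHomeomorph M (EuclideanSpace ℝ (Fin n))}
    (he : e ∈ IsManifold.maximalAtlas (𝓡 n) ∞ M) : ContinuousOn (chartDensity g e) e.target :=
  Real.continuous_sqrt.comp_continuousOn
    (Continuous.comp_continuousOn (g := Matrix.det) (by fun_prop) (hg.continuousOn e he))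

variable [MeasurableSpace M] [BorelSpace M] [IsManifold (𝓡 n) ∞ M] [SecondCountableTopology M]

/-- The Riemannian integral of a function supported in a chart domain. -/
theorem integral_riemannianVolume {g : TensorField n M} (hg : g.IsRegular)
    {e : OpenPartialHomeomorph M (EuclideanSpace ℝ (Fin n))}
    (he : e ∈ IsManifold.maximalAtlas (𝓡 n) ∞ M) {F : M → ℝ} (hF : Measurable F)
    (hsupp : ∀ x ∉ e.source, F x = 0) :
    ∫ x, F x ∂(riemannianVolume g) = ∫ u in e.target, chartDensity g e u * F (e.symm u) := by
  have hJ : AEMeasurable (fun u ↦ ENNReal.ofReal (chartDensity g e u))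
      (volume.restrict e.target) :=
    ((hg.continuousOn_chartDensity he).aemeasurable e.open_target.measurableSet).ennreal_ofReal
  rw [← setIntegral_eq_integral_of_forall_compl_eq_zero hsupp,
    riemannianVolume_restrict_source hg he, localVolume,
    integral_map (aemeasurable_symm_withDensity _ _) hF.aestronglyMeasurable,
    integral_withDensity_eq_integral_toReal_smul₀ hJ (by simp)]
  simp [ENNReal.toReal_ofReal (chartDensity_nonneg g e _)]

/-- The integral of a function supported in a chart domain, for a density with respect to the
Riemannian volume. -/
theorem integral_riemannianVolume_withDensity {g : TensorField n M} (hg : g.IsRegular)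
    {e : OpenPartialHomeomorph M (EuclideanSpace ℝ (Fin n))}
    (he : e ∈ IsManifold.maximalAtlas (𝓡 n) ∞ M) {w : M → ℝ} (hw : Measurable w)
    (hw0 : ∀ x, 0 ≤ w x) {F : M → ℝ} (hF : Measurable F) (hsupp : ∀ x ∉ e.source, F x = 0) :
    ∫ x, F x ∂((riemannianVolume g).withDensity fun x ↦ ENNReal.ofReal (w x)) =
      ∫ u in e.target, chartDensity g e u * (w (e.symm u) * F (e.symm u)) := by
  rw [integral_withDensity_eq_integral_toReal_smul hw.ennreal_ofReal (by simp)]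
  simp only [ENNReal.toReal_ofReal (hw0 _), smul_eq_mul]
  exact integral_riemannianVolume hg he (hw.mul hF) fun x hx ↦ by rw [hsupp x hx, mul_zero]

/-- The continuous density is bounded on a compact neighbourhood in a chart. -/
theorem isLocallyFiniteMeasure_riemannianVolume {g : TensorField n M} (hg : g.IsRegular) :
    IsLocallyFiniteMeasure (riemannianVolume g) := by
  refine ⟨fun x ↦ ?_⟩
  set e := chartAt (EuclideanSpace ℝ (Fin n)) x
  have he : e ∈ IsManifold.maximalAtlas (𝓡 n) ∞ M := IsManifold.chart_mem_maximalAtlas x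
  have hx : x ∈ e.source := mem_chart_source _ x
  obtain ⟨K, hK, hKt, hKc⟩ := local_compact_nhds (e.open_target.mem_nhds (e.map_source hx))
  obtain ⟨C, hC⟩ := hKc.exists_bound_of_continuousOn ((hg.continuousOn_chartDensity he).mono hKt)
  set A := e.source ∩ e ⁻¹' interior K
  have hA : IsOpen A := e.isOpen_inter_preimage isOpen_interior
  refine ⟨A, hA.mem_nhds ⟨hx, mem_interior_iff_mem_nhds.2 hK⟩, ?_⟩
  rw [← Measure.restrict_eq_self _ (Set.inter_subset_left : A ⊆ e.source),
    riemannianVolume_restrict_source hg he, localVolume_apply g e hA.measurableSet]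
  have hsub : e.target ∩ e.symm ⁻¹' A ⊆ K := by
    rintro u ⟨h1, h2⟩
    have := interior_subset h2.2
    rwa [e.right_inv h1] at this
  calc _ ≤ ∫⁻ u in K, ENNReal.ofReal (chartDensity g e u) := lintegral_mono_set hsub
    _ ≤ ∫⁻ u in K, ENNReal.ofReal C := by
        refine setLIntegral_mono' hKc.measurableSet fun u hu ↦ ENNReal.ofReal_le_ofReal ?_
        exact (le_abs_self _).trans (hC u hu)
    _ < ⊤ := by
        rw [setLIntegral_const]
        exact ENNReal.mul_lt_top ENNReal.ofReal_lt_top hKc.measure_lt_top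

/-- A zero integral of a positive function forces the volume to vanish. But a density positive at
one point is positive on a nonempty open set, which has positive Lebesgue measure. -/
theorem lintegral_riemannianVolume_ne_zero {g : TensorField n M} (hg : g.IsRegular)
    {e : OpenPartialHomeomorph M (EuclideanSpace ℝ (Fin n))}
    (he : e ∈ IsManifold.maximalAtlas (𝓡 n) ∞ M) {x : M} (hx : x ∈ e.source)
    (hpos : 0 < chartDensity g e (e x))
    {w : M → ℝ} (hw : Measurable w) (hw0 : ∀ x, 0 < w x) :
    ∫⁻ x, ENNReal.ofReal (w x) ∂(riemannianVolume g) ≠ 0 := by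
  intro h
  rw [lintegral_eq_zero_iff hw.ennreal_ofReal] at h
  have h0 : riemannianVolume g = 0 := by
    rw [← ae_eq_bot, ← Filter.eventually_false_iff_eq_bot]
    filter_upwards [h] with x hx
    simp [(hw0 x).not_ge] at hx
  have h1 : localVolume g e Set.univ = 0 := by
    rw [← riemannianVolume_restrict_source hg he, h0]; simp
  rw [localVolume_apply g e MeasurableSet.univ, Set.preimage_univ, Set.inter_univ,
    lintegral_eq_zero_iff' ((hg.continuousOn_chartDensity he).aemeasurable
      e.open_target.measurableSet).ennreal_ofReal] at h1
  have h2 : ∀ᵐ u ∂(volume : Measure (EuclideanSpace ℝ (Fin n))),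
      u ∈ e.target → ¬ 0 < chartDensity g e u := by
    rw [← ae_restrict_iff' e.open_target.measurableSet]
    filter_upwards [h1] with u hu
    simpa using hu
  have h3 : IsOpen (e.target ∩ chartDensity g e ⁻¹' Set.Ioi 0) :=
    (hg.continuousOn_chartDensity he).isOpen_inter_preimage e.open_target isOpen_Ioi
  refine (h3.measure_pos volume ⟨e x, e.map_source hx, hpos⟩).ne' ?_
  refine measure_mono_null (fun u hu ↦ ?_) h2
  simpa using hu

end VolumeIntegral

/-! ### Comparison of the volume densities of `Θ` and of the slice. -/

section SliceGram

variable {n m k : ℕ} {Θ : Type*} [TopologicalSpace Θ] [ChartedSpace (EuclideanSpace ℝ (Fin n)) Θ]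
  [IsManifold (𝓡 n) ∞ Θ] [RiemannianBundle (fun x : Θ ↦ TangentSpace (𝓡 n) x)]
  {χ : Θ → EuclideanSpace ℝ (Fin m)}
  [ChartedSpace (EuclideanSpace ℝ (Fin k)) (χ ⁻¹' {0})]

omit [IsManifold (𝓡 n) ∞ Θ] in
lemma inner_grad {f : Θ → ℝ} {θ : Θ} (v : TangentSpace (𝓡 n) θ) :
    inner ℝ (grad (n := n) f θ) v = differential (n := n) f θ v := by
  have : FiniteDimensional ℝ (TangentSpace (𝓡 n) θ) :=
    inferInstanceAs (FiniteDimensional ℝ (EuclideanSpace ℝ (Fin n)))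
  have : CompleteSpace (TangentSpace (𝓡 n) θ) := FiniteDimensional.complete ℝ _
  exact InnerProductSpace.toDual_symm_apply (𝕜 := ℝ)

omit [IsManifold (𝓡 n) ∞ Θ] [RiemannianBundle (fun x : Θ ↦ TangentSpace (𝓡 n) x)] in
lemma differential_coord (hχ : ContMDiff (𝓡 n) (𝓡 m) ∞ χ) (θ : Θ) (i : Fin m)
    (v : EuclideanSpace ℝ (Fin n)) :
    differential (n := n) (fun x ↦ χ x i) θ v = modelDeriv n m χ θ v i := by
  have h1 : MDifferentiableAt (𝓡 n) (𝓡 m) χ θ := (hχ θ).mdifferentiableAt (by simp)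
  have h2 := ((EuclideanSpace.proj (𝕜 := ℝ) i).hasFDerivAt (x := χ θ)).hasMFDerivAt.comp θ
    h1.hasMFDerivAt
  have h3 := h2.mfderiv
  exact DFunLike.congr_fun h3 v

variable {ε : Fin m ⊕ Fin k ≃ Fin n} {e : OpenPartialHomeomorph Θ (EuclideanSpace ℝ (Fin n))}
  {d : OpenPartialHomeomorph (χ ⁻¹' {0}) (EuclideanSpace ℝ (Fin k))}

-- In an adapted chart `χ` is a coordinate projection, and so is its differential.
omit [IsManifold (𝓡 n) ∞ Θ] [RiemannianBundle (fun x : Θ ↦ TangentSpace (𝓡 n) x)] in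
lemma IsAdapted.modelDeriv_gauge (h : IsAdapted ε e d) (hχ : ContMDiff (𝓡 n) (𝓡 m) ∞ χ)
    {θ : Θ} (hθ : θ ∈ e.source) (x) :
    modelDeriv n m χ θ (frameMap e (e θ) (splitEquiv ε x)) = x.1 := by
  have h1 : MDifferentiableAt (𝓡 n) (𝓡 n) e.symm (e θ) :=
    (contMDiffAt_symm_of_mem_maximalAtlas h.mem_atlas (e.map_source hθ)).mdifferentiableAt (by simp)
  have h2 : MDifferentiableAt (𝓡 n) (𝓡 m) χ (e.symm (e θ)) := (hχ _).mdifferentiableAt (by simp)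
  have h3 := mfderiv_comp (e θ) h2 h1
  have h4 : χ ∘ e.symm =ᶠ[𝓝 (e θ)] fun y ↦ ((splitEquiv ε).symm y).1 := by
    filter_upwards [e.open_target.mem_nhds (e.map_source hθ)] with y hy
    rw [← e.right_inv hy, h.fst_eq _ (e.map_target hy), e.right_inv hy]
    rfl
  have h5 : HasFDerivAt (fun y ↦ ((splitEquiv ε).symm y).1)
      ((ContinuousLinearMap.fst ℝ _ _).comp (splitEquiv ε).symm.toContinuousLinearMap) (e θ) :=
    ((ContinuousLinearMap.fst ℝ _ _).comp (splitEquiv ε).symm.toContinuousLinearMap).hasFDerivAt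
  rw [h4.mfderiv_eq, mfderiv_eq_fderiv, h5.fderiv] at h3
  have h6 : (modelDeriv n m χ (e.symm (e θ))).comp (frameMap e (e θ)) =
    (ContinuousLinearMap.fst ℝ _ _).comp (splitEquiv ε).symm.toContinuousLinearMap := h3.symm
  rw [e.left_inv hθ] at h6
  simpa using DFunLike.congr_fun h6 (splitEquiv ε x)

-- In the charts `d` and `e` the inclusion of the slice is `u ↦ (0, u)`.
omit [IsManifold (𝓡 n) ∞ Θ] [RiemannianBundle (fun x : Θ ↦ TangentSpace (𝓡 n) x)] in
lemma IsAdapted.modelDeriv_val (h : IsAdapted ε e d) [IsManifold (𝓡 k) ∞ (χ ⁻¹' {0})]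
    (hval : ContMDiff (𝓡 k) (𝓡 n) ∞ (Subtype.val : χ ⁻¹' {0} → Θ))
    {s : χ ⁻¹' {0}} (hs : (s : Θ) ∈ e.source) (w) :
    modelDeriv k n (Subtype.val : χ ⁻¹' {0} → Θ) s (frameMap d (d s) w) =
      frameMap e (e s) (splitEquiv ε (0, w)) := by
  obtain ⟨hsd, hes⟩ := h.slice s hs
  have h1 := modelDeriv_comp_symm hval h.mem_slice_atlas (d.map_source hsd)
  have h2 : Subtype.val ∘ d.symm =ᶠ[𝓝 (d s)] e.symm ∘ fun u ↦ splitEquiv ε (0, u) := by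
    have hc : ContinuousAt (Subtype.val ∘ d.symm) (d s) :=
      continuous_subtype_val.continuousAt.comp (d.continuousAt_symm (d.map_source hsd))
    have h3 : ∀ᶠ u in 𝓝 (d s), (Subtype.val ∘ d.symm) u ∈ e.source :=
      hc.eventually (e.open_source.mem_nhds (by simpa [d.left_inv hsd] using hs))
    filter_upwards [h3, d.open_target.mem_nhds (d.map_source hsd)] with u hu hu'
    have h4 := (h.slice (d.symm u) hu).2
    rw [d.right_inv hu'] at h4
    simp only [Function.comp, ← h4]
    exact (e.left_inv hu).symm
  have h5 : MDifferentiableAt (𝓡 n) (𝓡 n) e.symm (splitEquiv ε (0, d s)) := by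
    rw [← hes]
    exact (contMDiffAt_symm_of_mem_maximalAtlas h.mem_atlas
      (e.map_source hs)).mdifferentiableAt (by simp)
  have h6 : HasFDerivAt (fun u : EuclideanSpace ℝ (Fin k) ↦ splitEquiv ε (0, u))
      ((splitEquiv ε).toContinuousLinearMap.comp (ContinuousLinearMap.inr ℝ _ _)) (d s) :=
    ((splitEquiv ε).toContinuousLinearMap.comp (ContinuousLinearMap.inr ℝ _ _)).hasFDerivAt
  have h7 : modelDeriv k n (Subtype.val ∘ d.symm) (d s) =
      (frameMap e (splitEquiv ε (0, d s))).comp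
        ((splitEquiv ε).toContinuousLinearMap.comp (ContinuousLinearMap.inr ℝ _ _)) := by
    unfold modelDeriv
    rw [h2.mfderiv_eq, mfderiv_comp (d s) h5 h6.differentiableAt.mdifferentiableAt,
      mfderiv_eq_fderiv, h6.fderiv]
    rfl
  rw [h1, ← hes, d.left_inv hsd] at h7
  exact DFunLike.congr_fun h7 w

/-- In an adapted chart, the volume densities of `Θ` and of the slice differ by the factor
`√(det G_χ)`. -/
theorem IsAdapted.chartDensity_mul_sqrt (h : IsAdapted ε e d)
    (hχ : ContMDiff (𝓡 n) (𝓡 m) ∞ χ) [IsManifold (𝓡 k) ∞ (χ ⁻¹' {0})]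
    (hval : ContMDiff (𝓡 k) (𝓡 n) ∞ (Subtype.val : χ ⁻¹' {0} → Θ))
    {s : χ ⁻¹' {0}} (hs : (s : Θ) ∈ e.source) :
    0 < (constraintGram (n := n) χ (s : Θ)).det ∧
    0 < chartDensity (inducedMetric (n := n) (Subtype.val : χ ⁻¹' {0} → Θ)) d (d s) ∧
    chartDensity (metricTensor n Θ) e (e s) * √(constraintGram (n := n) χ (s : Θ)).det =
      chartDensity (inducedMetric (n := n) (Subtype.val : χ ⁻¹' {0} → Θ)) d (d s) := by
  obtain ⟨hsd, hes⟩ := h.slice s hs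
  let V := TangentSpace (𝓡 n) (s : Θ)
  let φ : EuclideanSpace ℝ (Fin n) →ₗ[ℝ] V := (frameMap e (e (s : Θ))).toLinearMap
  have hφ : Function.Injective φ := frameMap_injective h.mem_atlas (e.map_source hs)
  have hφs : LinearMap.range φ = ⊤ := LinearMap.range_eq_top.2
    (LinearMap.surjective_of_injective (f := (frameMap e (e (s : Θ))).toLinearMap) hφ)
  -- `a` are the coordinate vectors transverse to the slice, `b` those tangent to it, and `N` the
  -- gradients of the components of `χ`.
  let a : Fin m → V := fun i ↦ φ (EuclideanSpace.single (ε (Sum.inl i)) 1)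
  let b : Fin k → V := fun i ↦ φ (EuclideanSpace.single (ε (Sum.inr i)) 1)
  let N : Fin m → V := fun i ↦ grad (n := n) (fun x ↦ χ x i) (s : Θ)
  have hab : Sum.elim a b = φ ∘ (EuclideanSpace.basisFun (Fin n) ℝ).toBasis ∘ ε := by
    ext (i | i) <;> simp [a, b]
  have hM : (chartGram (metricTensor n Θ) e (e s)).det = (Matrix.gram ℝ (Sum.elim a b)).det := by
    rw [← Matrix.det_submatrix_equiv_self ε]
    congr 1
    ext i j
    rw [hab, Matrix.gram_apply, Matrix.submatrix_apply]
    simp only [chartGram, Matrix.of_apply, e.left_inv hs, Function.comp,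
      OrthonormalBasis.coe_toBasis, EuclideanSpace.basisFun_apply]
    rfl
  have hD : chartGram (inducedMetric (n := n) (Subtype.val : χ ⁻¹' {0} → Θ)) d (d s) =
      Matrix.gram ℝ b := by
    ext i j
    simp only [chartGram, Matrix.of_apply, inducedMetric_val, d.left_inv hsd,
      h.modelDeriv_val hval hs, splitEquiv_single_right]
    rfl
  have key : (Matrix.gram ℝ (Sum.elim a b)).det * (Matrix.gram ℝ N).det =
      (Matrix.gram ℝ b).det := by
    refine det_gram_sumElim_mul_det_gram (fun v ↦ ?_) (fun i j ↦ ?_) fun i j ↦ ?_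
    · rw [hab, Set.range_comp, Set.range_comp, ε.surjective.range_eq, Set.image_univ,
        Submodule.span_image, Module.Basis.span_eq, Submodule.map_top, hφs]
      trivial
    · have h1 := (inner_grad (f := fun x ↦ χ x i) (a j)).trans (differential_coord hχ _ i (a j))
      have h2 := h.modelDeriv_gauge hχ hs (EuclideanSpace.single j 1, 0)
      rw [splitEquiv_single_left] at h2
      refine h1.trans ((congrArg (fun y : EuclideanSpace ℝ (Fin m) ↦ y i) h2).trans ?_)
      simp
    · have h1 := (inner_grad (f := fun x ↦ χ x i) (b j)).trans (differential_coord hχ _ i (b j))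
      have h2 := h.modelDeriv_gauge hχ hs (0, EuclideanSpace.single j 1)
      rw [splitEquiv_single_right] at h2
      refine h1.trans ((congrArg (fun y : EuclideanSpace ℝ (Fin m) ↦ y i) h2).trans ?_)
      simp
  have hbpos : 0 < (Matrix.gram ℝ b).det := by
    refine (Matrix.posDef_gram_of_linearIndependent ?_).det_pos
    have h1 : LinearIndependent ℝ (fun i ↦ EuclideanSpace.single (ε (Sum.inr i)) (1 : ℝ)) := by
      have h2 := (EuclideanSpace.basisFun (Fin n) ℝ).toBasis.linearIndependent.comp
        (fun i ↦ ε (Sum.inr i)) (ε.injective.comp Sum.inr_injective)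
      simpa [Function.comp_def] using h2
    exact h1.map' φ (LinearMap.ker_eq_bot.2 hφ)
  have hMnn : 0 ≤ (Matrix.gram ℝ (Sum.elim a b)).det :=
    (Matrix.posSemidef_gram (𝕜 := ℝ) (Sum.elim a b)).det_nonneg
  have hN : constraintGram (n := n) χ (s : Θ) = Matrix.gram ℝ N := rfl
  rw [hN]
  unfold chartDensity
  rw [hM, hD]
  refine ⟨?_, Real.sqrt_pos.2 hbpos, ?_⟩
  -- A positive product with one nonnegative factor has its other factor positive.
  · rw [← key] at hbpos
    exact pos_of_mul_pos_right hbpos hMnn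
  · rw [← key, Real.sqrt_mul hMnn]

end SliceGram

/-! ### Convergence inside one adapted chart. -/

section Convergence

variable {n m k : ℕ} {Θ : Type*} [TopologicalSpace Θ] [ChartedSpace (EuclideanSpace ℝ (Fin n)) Θ]
  [IsManifold (𝓡 n) ∞ Θ] [RiemannianBundle (fun x : Θ ↦ TangentSpace (𝓡 n) x)]
  [IsContMDiffRiemannianBundle (𝓡 n) ∞ (EuclideanSpace ℝ (Fin n))
    (fun x : Θ ↦ TangentSpace (𝓡 n) x)]
  {χ : Θ → EuclideanSpace ℝ (Fin m)}
  [ChartedSpace (EuclideanSpace ℝ (Fin k)) (χ ⁻¹' {0})] [IsManifold (𝓡 k) ∞ (χ ⁻¹' {0})]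
  {ε : Fin m ⊕ Fin k ≃ Fin n} {e : OpenPartialHomeomorph Θ (EuclideanSpace ℝ (Fin n))}
  {d : OpenPartialHomeomorph (χ ⁻¹' {0}) (EuclideanSpace ℝ (Fin k))}

/-- Near `s` the function is a quotient of two chart densities, so continuity of the gradients need
not be discussed. -/
theorem IsAdapted.continuousAt_inv_sqrt (h : IsAdapted ε e d) (hχ : ContMDiff (𝓡 n) (𝓡 m) ∞ χ)
    (hval : ContMDiff (𝓡 k) (𝓡 n) ∞ (Subtype.val : χ ⁻¹' {0} → Θ))
    {s : χ ⁻¹' {0}} (hs : (s : Θ) ∈ e.source) :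
    ContinuousAt (fun s : χ ⁻¹' {0} ↦ 1 / √(constraintGram (n := n) χ (s : Θ)).det) s := by
  have hev : (fun s : χ ⁻¹' {0} ↦ 1 / √(constraintGram (n := n) χ (s : Θ)).det) =ᶠ[𝓝 s]
      fun s ↦ chartDensity (metricTensor n Θ) e (e s) /
        chartDensity (inducedMetric (n := n) (Subtype.val : χ ⁻¹' {0} → Θ)) d (d s) := by
    filter_upwards [continuous_subtype_val.continuousAt.eventually (e.open_source.mem_nhds hs)]
      with s' hs'
    obtain ⟨h1, h2, h3⟩ := h.chartDensity_mul_sqrt hχ hval hs'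
    have h4 := Real.sqrt_pos.2 h1
    rw [div_eq_div_iff h4.ne' h2.ne', one_mul, h3]
  refine ContinuousAt.congr_of_eventuallyEq ?_ hev
  have hsd := (h.slice s hs).1
  refine ContinuousAt.div ?_ ?_ (h.chartDensity_mul_sqrt hχ hval hs).2.1.ne'
  · exact ContinuousAt.comp (f := fun s : χ ⁻¹' {0} ↦ e s)
      ((metricTensor_isRegular.continuousOn_chartDensity h.mem_atlas).continuousAt
        (e.open_target.mem_nhds (e.map_source hs)))
      ((e.continuousAt hs).comp (f := Subtype.val) continuous_subtype_val.continuousAt)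
  · exact (((inducedMetric_isRegular hval).continuousOn_chartDensity h.mem_slice_atlas).continuousAt
      (d.open_target.mem_nhds (d.map_source hsd))).comp (d.continuousAt hsd)

-- The point with coordinates `(0, u)` satisfies `χ = 0`, hence lies on the slice.
omit [IsManifold (𝓡 n) ∞ Θ] [RiemannianBundle (fun x : Θ ↦ TangentSpace (𝓡 n) x)]
  [IsContMDiffRiemannianBundle (𝓡 n) ∞ (EuclideanSpace ℝ (Fin n))
    (fun x : Θ ↦ TangentSpace (𝓡 n) x)] [IsManifold (𝓡 k) ∞ (χ ⁻¹' {0})] in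
lemma IsAdapted.exists_of_mem_target (h : IsAdapted ε e d) {u : EuclideanSpace ℝ (Fin k)}
    (hu : splitEquiv ε (0, u) ∈ e.target) :
    ∃ s ∈ d.source, (s : Θ) ∈ e.source ∧ d s = u ∧ e s = splitEquiv ε (0, u) := by
  have h1 := h.fst_eq _ (e.map_target hu)
  rw [e.right_inv hu, ContinuousLinearEquiv.symm_apply_apply] at h1
  obtain ⟨h2, h3⟩ := h.slice ⟨e.symm (splitEquiv ε (0, u)), h1.symm⟩ (e.map_target hu)
  refine ⟨_, h2, e.map_target hu, ?_, e.right_inv hu⟩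
  have h4 := h3
  rw [e.right_inv hu] at h4
  exact ((Prod.ext_iff.1 ((splitEquiv ε).injective h4)).2).symm

omit [IsManifold (𝓡 n) ∞ Θ] [RiemannianBundle (fun x : Θ ↦ TangentSpace (𝓡 n) x)]
  [IsContMDiffRiemannianBundle (𝓡 n) ∞ (EuclideanSpace ℝ (Fin n))
    (fun x : Θ ↦ TangentSpace (𝓡 n) x)] [ChartedSpace (EuclideanSpace ℝ (Fin n)) Θ] in
/-- A compactly supported function on a chart domain, read in the chart and extended by zero. -/
lemma continuous_indicator_comp_symm [T2Space Θ] {J : EuclideanSpace ℝ (Fin n) → ℝ}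
    (hJ : ContinuousOn J e.target) {f : Θ → ℝ} (hf : Continuous f) (hfc : HasCompactSupport f)
    (hfe : tsupport f ⊆ e.source) :
    Continuous (e.target.indicator fun y ↦ J y * f (e.symm y)) ∧
      HasCompactSupport (e.target.indicator fun y ↦ J y * f (e.symm y)) := by
  have hK : IsCompact (e '' tsupport f) := hfc.isCompact.image_of_continuousOn
    (e.continuousOn.mono hfe)
  have h0 : ∀ y ∉ e '' tsupport f, e.target.indicator (fun y ↦ J y * f (e.symm y)) y = 0 := by
    intro y hy
    by_cases hyt : y ∈ e.target
    · rw [Set.indicator_of_mem hyt, image_eq_zero_of_notMem_tsupport (f := f), mul_zero]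
      exact fun h ↦ hy ⟨_, h, e.right_inv hyt⟩
    · exact Set.indicator_of_notMem hyt _
  -- The target and the complement of the compact image are open and cover the space; on the second
  -- the function is zero.
  refine ⟨continuous_iff_continuousAt.2 fun y ↦ ?_, HasCompactSupport.intro hK h0⟩
  by_cases hy : y ∈ e.target
  · refine ContinuousAt.congr ?_ ((Set.eqOn_indicator (s := e.target)
      (f := fun y ↦ J y * f (e.symm y))).symm.eventuallyEq_of_mem (e.open_target.mem_nhds hy))
    exact (hJ.continuousAt (e.open_target.mem_nhds hy)).mul
      (hf.continuousAt.comp (e.continuousAt_symm hy))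
  · have hy' : y ∉ e '' tsupport f := by
      rintro ⟨θ, hθ, rfl⟩
      exact hy (e.map_source (hfe hθ))
    refine (continuousAt_const (y := (0 : ℝ))).congr ?_
    filter_upwards [hK.isClosed.isOpen_compl.mem_nhds hy'] with z hz using (h0 z hz).symm

variable [T2Space Θ] [SecondCountableTopology Θ] [MeasurableSpace Θ] [BorelSpace Θ]

/-- The mollified integrals of a function supported in an adapted chart converge. -/
theorem IsAdapted.tendsto_integral (h : IsAdapted ε e d) (hχ : ContMDiff (𝓡 n) (𝓡 m) ∞ χ)
    (hval : ContMDiff (𝓡 k) (𝓡 n) ∞ (Subtype.val : χ ⁻¹' {0} → Θ))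
    {ρ : Θ → ℝ} (hρ : Continuous ρ) (hρ0 : ∀ θ, 0 ≤ ρ θ) {w : χ ⁻¹' {0} → ℝ} (hw : Measurable w)
    (hwρ : ∀ s, w s = ρ s * (1 / √(constraintGram (n := n) χ (s : Θ)).det))
    {η : EuclideanSpace ℝ (Fin m) → ℝ} (hη : Measurable η)
    (hηb : ∃ C, ∀ y, |η y| ≤ C) (hηc : HasCompactSupport η) (hη1 : ∫ y, η y = 1)
    {f : Θ → ℝ} (hf : Continuous f) (hfc : HasCompactSupport f) (hfe : tsupport f ⊆ e.source) :
    Tendsto (fun t : ℝ ↦ ∫ θ, f θ * ((t ^ m)⁻¹ * η (t⁻¹ • χ θ))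
        ∂((riemannianVolume (metricTensor n Θ)).withDensity fun θ ↦ ENNReal.ofReal (ρ θ)))
      (𝓝[>] 0)
      (𝓝 (∫ s, f s ∂((sliceVolume n k χ).withDensity fun s ↦ ENNReal.ofReal (w s)))) := by
  have hf0 : ∀ θ ∉ e.source, f θ = 0 := fun θ hθ ↦
    image_eq_zero_of_notMem_tsupport fun h ↦ hθ (hfe h)
  set J := chartDensity (metricTensor n Θ) e
  have hJ : ContinuousOn J e.target :=
    metricTensor_isRegular.continuousOn_chartDensity h.mem_atlas
  have hJρ : ContinuousOn (fun y ↦ J y * ρ (e.symm y)) e.target :=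
    hJ.mul (hρ.comp_continuousOn e.continuousOn_symm)
  obtain ⟨hFcont, hFcomp⟩ := continuous_indicator_comp_symm hJρ hf hfc hfe
  set F := e.target.indicator fun y ↦ J y * ρ (e.symm y) * f (e.symm y) with hF
  have hFin : ∀ y ∈ e.target, F y = J y * ρ (e.symm y) * f (e.symm y) := fun y hy ↦ by
    rw [hF, Set.indicator_of_mem hy]
  have hFout : ∀ y ∉ e.target, F y = 0 := fun y hy ↦ by rw [hF, Set.indicator_of_notMem hy]
  have hlim := tendsto_integral_mul_mollifier (F := F ∘ splitEquiv ε)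
    (hFcont.comp (splitEquiv ε).continuous)
    (hFcomp.comp_homeomorph (splitEquiv ε).toHomeomorph) hη hηb hηc hη1
  have hright : ∫ s, f s ∂((sliceVolume n k χ).withDensity fun s ↦ ENNReal.ofReal (w s)) =
      ∫ u, (F ∘ splitEquiv ε) (0, u) := by
    have hw0 : ∀ s, 0 ≤ w s := fun s ↦ by
      rw [hwρ]
      exact mul_nonneg (hρ0 _) (by positivity)
    rw [sliceVolume, integral_riemannianVolume_withDensity (inducedMetric_isRegular hval)
      h.mem_slice_atlas hw hw0 (F := fun s ↦ f s) (hf.measurable.comp measurable_subtype_coe)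
      (fun s hs ↦ hf0 _ fun hs' ↦ hs (h.slice s hs').1),
      ← integral_indicator d.open_target.measurableSet]
    congr 1
    ext u
    by_cases hu : splitEquiv ε (0, u) ∈ e.target
    · obtain ⟨s, hsd, hse, rfl, hes⟩ := h.exists_of_mem_target hu
      rw [Set.indicator_of_mem (d.map_source hsd), Function.comp, hFin _ hu,
        d.left_inv hsd, ← hes, e.left_inv hse, hwρ]
      -- The factor `√det G_χ` in the slice density cancels the one in the weight `w`.
      obtain ⟨h1, -, h3⟩ := h.chartDensity_mul_sqrt hχ hval hse
      rw [← h3]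
      have h4 := (Real.sqrt_pos.2 h1).ne'
      field_simp
      exact mul_rotate _ _ _
    -- The chart `d` may reach beyond `e`, but `f` vanishes there.
    · rw [Function.comp, hFout _ hu]
      refine Set.indicator_apply_eq_zero.2 fun hu' ↦ ?_
      rw [hf0, mul_zero, mul_zero]
      intro hs
      have h1 := (h.slice _ hs).2
      rw [d.right_inv hu'] at h1
      exact hu (h1 ▸ e.map_source hs)
  rw [hright]
  refine hlim.congr fun t ↦ ?_
  have hmoll : Measurable fun y : EuclideanSpace ℝ (Fin m) ↦ (t ^ m)⁻¹ * η (t⁻¹ • y) :=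
    measurable_const.mul (hη.comp (by fun_prop))
  rw [integral_riemannianVolume_withDensity metricTensor_isRegular h.mem_atlas hρ.measurable hρ0
    (F := fun θ ↦ f θ * ((t ^ m)⁻¹ * η (t⁻¹ • χ θ)))
    (hf.measurable.mul (hmoll.comp hχ.continuous.measurable))
    (fun θ hθ ↦ by rw [hf0 θ hθ, zero_mul]), ← integral_indicator e.open_target.measurableSet,
    ← (splitEquiv_measurePreserving ε).integral_comp
      (splitEquiv ε).toHomeomorph.measurableEmbedding]
  congr 1
  ext x
  by_cases hx : splitEquiv ε x ∈ e.target
  -- Here `χ` becomes `x.1`, so the mollifier takes the product form of the Euclidean lemma.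
  · have h1 := h.fst_eq _ (e.map_target hx)
    rw [e.right_inv hx, ContinuousLinearEquiv.symm_apply_apply] at h1
    rw [Set.indicator_of_mem hx, Function.comp, hFin _ hx, h1]
    ring
  · rw [Set.indicator_of_notMem hx, Function.comp, hFout _ hx, zero_mul]

end Convergence

/-! ### Uniqueness of the constrained measure. -/

section Uniqueness

variable {Θ : Type*} [TopologicalSpace Θ] [MeasurableSpace Θ] [BorelSpace Θ] {m : ℕ}
  {χ : Θ → EuclideanSpace ℝ (Fin m)}

lemma exists_mollifier (m : ℕ) : ∃ η : EuclideanSpace ℝ (Fin m) → ℝ, Measurable η ∧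
    (∃ C, ∀ y, |η y| ≤ C) ∧ HasCompactSupport η ∧ ∫ y, η y = 1 := by
  set B : Set (EuclideanSpace ℝ (Fin m)) := Metric.closedBall 0 1
  have hB : MeasurableSet B := Metric.isClosed_closedBall.measurableSet
  have hpos : 0 < volume.real B :=
    ENNReal.toReal_pos (Metric.measure_closedBall_pos volume 0 one_pos).ne'
      (isCompact_closedBall _ _).measure_lt_top.ne
  refine ⟨B.indicator fun _ ↦ (volume.real B)⁻¹, measurable_const.indicator hB,
    ⟨(volume.real B)⁻¹, fun y ↦ ?_⟩, ?_, ?_⟩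
  · by_cases hy : y ∈ B
    · simp [hy, abs_of_pos hpos]
    · simp [hy, hpos.le]
  · exact HasCompactSupport.intro (isCompact_closedBall 0 1) fun y hy ↦
      Set.indicator_of_notMem hy _
  · rw [integral_indicator_const _ hB, smul_eq_mul, mul_inv_cancel₀ hpos.ne']

/-- The constrained measure is unique. -/
theorem IsConstrainedMeasure.unique [T2Space Θ] [SecondCountableTopology Θ]
    [LocallyCompactSpace Θ] (hχ : Continuous χ) {μ : Measure Θ} {ν ν' : Measure (χ ⁻¹' {0})}
    (h : IsConstrainedMeasure μ χ ν) (h' : IsConstrainedMeasure μ χ ν') : ν = ν' := by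
  obtain ⟨η, hη, hηb, hηc, hη1⟩ := exists_mollifier m
  have hclosed : IsClosed (χ ⁻¹' {0}) := isClosed_singleton.preimage hχ
  have hemb := hclosed.isClosedEmbedding_subtypeVal
  have := h.locallyFinite
  have := h'.locallyFinite
  -- Test functions live on `Θ`, so both measures are pushed forward there. Closedness of the slice
  -- keeps them finite on compact sets, and integrals of compactly supported continuous functions
  -- then determine them.
  have hfin : ∀ (ν : Measure (χ ⁻¹' {0})) [IsLocallyFiniteMeasure ν],
      IsLocallyFiniteMeasure (ν.map Subtype.val) := by
    intro ν _
    refine ⟨fun x ↦ ?_⟩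
    obtain ⟨K, hK, hx⟩ := exists_compact_mem_nhds x
    refine ⟨K, hx, ?_⟩
    rw [hemb.measurableEmbedding.map_apply]
    exact (hemb.isCompact_preimage hK).measure_lt_top
  have := hfin ν
  have := hfin ν'
  have heq : ν.map Subtype.val = ν'.map Subtype.val := by
    refine Measure.ext_of_integral_eq_on_compactlySupported fun f ↦ ?_
    rw [hemb.measurableEmbedding.integral_map, hemb.measurableEmbedding.integral_map]
    exact tendsto_nhds_unique (h.tendsto η hη hηb hηc hη1 f f.continuous f.hasCompactSupport)
      (h'.tendsto η hη hηb hηc hη1 f f.continuous f.hasCompactSupport)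
  ext A hA
  have hA' := Set.preimage_image_eq A (Subtype.val_injective (p := (· ∈ χ ⁻¹' {0})))
  rw [← hA', ← hemb.measurableEmbedding.map_apply, heq, hemb.measurableEmbedding.map_apply]

end Uniqueness

/-! ### From local to global convergence. -/

section Localization

variable {Θ : Type*} [TopologicalSpace Θ] [MeasurableSpace Θ] [BorelSpace Θ] {m : ℕ}
  {χ : Θ → EuclideanSpace ℝ (Fin m)}

omit [MeasurableSpace Θ] [BorelSpace Θ] in
/-- Mollifiers see nothing of a compactly supported function that vanishes near the slice. -/
lemma eventually_mul_mollifier_eq_zero (hχ : Continuous χ)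
    {η : EuclideanSpace ℝ (Fin m) → ℝ} (hηc : HasCompactSupport η) {f : Θ → ℝ}
    (hfc : HasCompactSupport f) (hf : tsupport f ⊆ {θ | χ θ ≠ 0}) :
    ∀ᶠ t : ℝ in 𝓝[>] 0, ∀ θ, f θ * ((t ^ m)⁻¹ * η (t⁻¹ • χ θ)) = 0 := by
  obtain ⟨R, hR⟩ := hηc.isCompact.isBounded.subset_closedBall 0
  obtain ⟨δ, hδ, hδf⟩ : ∃ δ > 0, ∀ θ ∈ tsupport f, δ ≤ ‖χ θ‖ := by
    rcases (tsupport f).eq_empty_or_nonempty with he | hne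
    · exact ⟨1, one_pos, by simp [he]⟩
    · obtain ⟨θ, hθ, hmin⟩ := hfc.isCompact.exists_isMinOn hne hχ.norm.continuousOn
      exact ⟨‖χ θ‖, norm_pos_iff.2 (hf hθ), fun θ' hθ' ↦ hmin hθ'⟩
  -- Once `t |R| < δ`, the point `χ θ / t` leaves the ball containing the support of `η`. The
  -- absolute value covers a negative `R`, possible when that support is empty.
  have hlim : Tendsto (fun t : ℝ ↦ t * |R|) (𝓝[>] 0) (𝓝 0) :=
    ((continuous_mul_const |R|).tendsto' 0 0 (by simp)).mono_left nhdsWithin_le_nhds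
  filter_upwards [self_mem_nhdsWithin, hlim.eventually (gt_mem_nhds hδ)] with t ht htδ θ
  have ht : 0 < t := ht
  by_cases hθ : θ ∈ tsupport f
  · rw [image_eq_zero_of_notMem_tsupport (f := η), mul_zero, mul_zero]
    intro h
    have h1 := mem_closedBall_zero_iff.1 (hR h)
    rw [norm_smul, norm_inv, Real.norm_of_nonneg ht.le, inv_mul_le_iff₀ ht] at h1
    have h2 := mul_le_mul_of_nonneg_left (le_abs_self R) ht.le
    linarith [hδf θ hθ]
  · rw [image_eq_zero_of_notMem_tsupport hθ, zero_mul]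

/-- To be the constrained measure is a local property. -/
theorem isConstrainedMeasure_of_local [T2Space Θ] [LocallyCompactSpace Θ] (hχ : Continuous χ)
    {μ : Measure Θ} [IsFiniteMeasure μ] {ν : Measure (χ ⁻¹' {0})} (hν : IsLocallyFiniteMeasure ν)
    (hloc : ∀ s : χ ⁻¹' {0}, ∃ U : Set Θ, IsOpen U ∧ (s : Θ) ∈ U ∧
      ∀ η : EuclideanSpace ℝ (Fin m) → ℝ, Measurable η → (∃ C, ∀ y, |η y| ≤ C) →
      HasCompactSupport η → ∫ y, η y = 1 →
      ∀ f : Θ → ℝ, Continuous f → HasCompactSupport f → tsupport f ⊆ U →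
        Tendsto (fun ε : ℝ ↦ ∫ θ, f θ * ((ε ^ m)⁻¹ * η (ε⁻¹ • χ θ)) ∂μ) (𝓝[>] 0)
          (𝓝 (∫ s, f s ∂ν))) :
    IsConstrainedMeasure μ χ ν := by
  refine ⟨hν, fun η hη hηb hηc hη1 f hf hfc ↦ ?_⟩
  -- A point off the slice has the neighbourhood `χ ≠ 0`, for which the limit and the mollified
  -- integrals near `ε = 0` are both zero.
  have hloc' : ∀ θ : Θ, ∃ U : Set Θ, IsOpen U ∧ θ ∈ U ∧
      ∀ f : Θ → ℝ, Continuous f → HasCompactSupport f → tsupport f ⊆ U →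
        Tendsto (fun ε : ℝ ↦ ∫ θ, f θ * ((ε ^ m)⁻¹ * η (ε⁻¹ • χ θ)) ∂μ) (𝓝[>] 0)
          (𝓝 (∫ s, f s ∂ν)) := by
    intro θ
    by_cases hθ : χ θ = 0
    · obtain ⟨U, hU, hsU, h⟩ := hloc ⟨θ, hθ⟩
      exact ⟨U, hU, hsU, h η hη hηb hηc hη1⟩
    · refine ⟨{θ | χ θ ≠ 0}, isOpen_ne_fun hχ continuous_const, hθ, fun f _ hfc hf ↦ ?_⟩
      have h0 : ∫ s, f s ∂ν = 0 := by
        refine integral_eq_zero_of_ae (Eventually.of_forall fun s ↦ ?_)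
        exact image_eq_zero_of_notMem_tsupport fun h ↦ hf h s.2
      rw [h0]
      refine tendsto_const_nhds.congr' ?_
      filter_upwards [eventually_mul_mollifier_eq_zero hχ hηc hfc hf] with t ht
      simp [ht]
  choose U hU hmem hlim using hloc'
  obtain ⟨t, -, ht⟩ := hfc.isCompact.elim_nhds_subcover U fun θ _ ↦ (hU θ).mem_nhds (hmem θ)
  have hcover : tsupport f ⊆ ⋃ i : Fin t.card, U (t.equivFin.symm i) := by
    intro θ hθ
    obtain ⟨x, hx, hθx⟩ := Set.mem_iUnion₂.1 (ht hθ)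
    exact Set.mem_iUnion.2 ⟨t.equivFin ⟨x, hx⟩, by simpa using hθx⟩
  -- A partition of unity on the support of `f` splits `f` into finitely many pieces, each supported
  -- in one good open set.
  obtain ⟨p, hpU, hp1, -, -⟩ := exists_continuous_sum_one_of_isOpen_isCompact
    (fun i : Fin t.card ↦ hU (t.equivFin.symm i)) hfc.isCompact hcover
  have hsum : ∀ θ, f θ = ∑ i, p i θ * f θ := by
    intro θ
    rw [← Finset.sum_mul]
    by_cases hθ : θ ∈ tsupport f
    · have := hp1 hθ
      simp only [Finset.sum_apply, Pi.one_apply] at this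
      rw [this, one_mul]
    · rw [image_eq_zero_of_notMem_tsupport hθ, mul_zero]
  have hpc : ∀ i, Continuous fun θ ↦ p i θ * f θ := fun i ↦ (p i).continuous.mul hf
  have hpcomp : ∀ i, HasCompactSupport fun θ ↦ p i θ * f θ := fun i ↦ hfc.mul_left
  obtain ⟨C, hC⟩ := hηb
  have hleft : ∀ ε : ℝ, 0 < ε → ∫ θ, f θ * ((ε ^ m)⁻¹ * η (ε⁻¹ • χ θ)) ∂μ =
      ∑ i, ∫ θ, (p i θ * f θ) * ((ε ^ m)⁻¹ * η (ε⁻¹ • χ θ)) ∂μ := by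
    intro ε hε
    rw [← integral_finsetSum]
    · refine integral_congr_ae (Eventually.of_forall fun θ ↦ ?_)
      simp only [← Finset.sum_mul]
      rw [Finset.sum_mul (f := fun i ↦ p i θ), ← hsum θ]
    · intro i _
      refine ((hpc i).integrable_of_hasCompactSupport (hpcomp i)).mul_bdd (c := (ε ^ m)⁻¹ * C) ?_ ?_
      · exact (measurable_const.mul (hη.comp
          (hχ.measurable.const_smul ε⁻¹))).aestronglyMeasurable
      · refine Eventually.of_forall fun θ ↦ ?_
        rw [norm_mul, Real.norm_of_nonneg (by positivity)]
        exact mul_le_mul_of_nonneg_left (hC _) (by positivity)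
  have hright : ∫ s, f s ∂ν = ∑ i, ∫ s : χ ⁻¹' {0}, p i s * f s ∂ν := by
    rw [← integral_finsetSum]
    · exact integral_congr_ae (Eventually.of_forall fun s ↦ hsum s)
    · intro i _
      have hclosed : IsClosed (χ ⁻¹' {0}) := isClosed_singleton.preimage hχ
      exact ((hpc i).comp continuous_subtype_val).integrable_of_hasCompactSupport
        ((hpcomp i).comp_isClosedEmbedding hclosed.isClosedEmbedding_subtypeVal)
  rw [hright]
  refine Tendsto.congr' ?_ (tendsto_finsetSum _ fun i _ ↦ hlim _ _ (hpc i) (hpcomp i)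
    ((tsupport_mul_subset_left (f := p i) (g := f)).trans (hpU i)))
  filter_upwards [self_mem_nhdsWithin] with ε hε using (hleft ε hε).symm

end Localization

/-! ### Normalizing a density. -/

section Normalization

variable {S : Type*} [MeasurableSpace S] {v : Measure S} {ρ : S → ℝ}

lemma normalizedDensity_eq_smul (hρ : Measurable ρ) :
    normalizedDensity v ρ = (∫⁻ x, ENNReal.ofReal (ρ x) ∂v)⁻¹ •
      v.withDensity fun s ↦ ENNReal.ofReal (ρ s) :=
  withDensity_smul _ hρ.ennreal_ofReal

lemma withDensity_ofReal_const_mul {c : ℝ} (hc : 0 ≤ c) (hρ : Measurable ρ) :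
    (v.withDensity fun s ↦ ENNReal.ofReal (c * ρ s)) =
      ENNReal.ofReal c • v.withDensity fun s ↦ ENNReal.ofReal (ρ s) := by
  simp only [ENNReal.ofReal_mul hc]
  exact withDensity_smul _ hρ.ennreal_ofReal

lemma isProbabilityMeasure_normalizedDensity (hρ : Measurable ρ)
    (h0 : ∫⁻ x, ENNReal.ofReal (ρ x) ∂v ≠ 0) (htop : ∫⁻ x, ENNReal.ofReal (ρ x) ∂v ≠ ⊤) :
    IsProbabilityMeasure (normalizedDensity v ρ) := by
  refine ⟨?_⟩
  rw [normalizedDensity_eq_smul hρ, Measure.smul_apply, withDensity_apply _ MeasurableSet.univ,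
    Measure.restrict_univ, smul_eq_mul, ENNReal.inv_mul_cancel h0 htop]

lemma toNNReal_smul_normalizedDensity (hρ : Measurable ρ)
    (h0 : ∫⁻ x, ENNReal.ofReal (ρ x) ∂v ≠ 0) (htop : ∫⁻ x, ENNReal.ofReal (ρ x) ∂v ≠ ⊤) :
    (∫⁻ x, ENNReal.ofReal (ρ x) ∂v).toNNReal • normalizedDensity v ρ =
      v.withDensity fun s ↦ ENNReal.ofReal (ρ s) := by
  have h (a : ℝ≥0) (ν : Measure S) : a • ν = (a : ℝ≥0∞) • ν := rfl
  rw [normalizedDensity_eq_smul hρ, h, ENNReal.coe_toNNReal htop, smul_smul,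
    ENNReal.mul_inv_cancel h0 htop, one_smul]

/-- A probability measure proportional to a density is the normalized density. -/
lemma eq_normalizedDensity_of_smul_eq (hρ : Measurable ρ) {c : ℝ} (hc : 0 < c)
    {a : ℝ≥0} (ha : 0 < a)
    {ν : Measure S} [IsProbabilityMeasure ν]
    (h : a • ν = v.withDensity fun s ↦ ENNReal.ofReal (c * ρ s)) :
    ∫⁻ x, ENNReal.ofReal (ρ x) ∂v ≠ ⊤ ∧ ν = normalizedDensity v ρ := by
  rw [withDensity_ofReal_const_mul hc.le hρ] at h
  set I := ∫⁻ x, ENNReal.ofReal (ρ x) ∂v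
  have hc0 : ENNReal.ofReal c ≠ 0 := by simpa using hc
  -- Comparing total masses identifies the free constant `a` and shows at once that `I` is finite.
  have hmass : (a : ℝ≥0∞) = ENNReal.ofReal c * I := by
    have := congrArg (fun ν : Measure S ↦ ν Set.univ) h
    simpa only [Measure.smul_apply, measure_univ, withDensity_apply _ MeasurableSet.univ,
      Measure.restrict_univ, ENNReal.smul_def, smul_eq_mul, mul_one] using this
  have hI : I ≠ ⊤ := by
    intro hI
    rw [hI, ENNReal.mul_top hc0] at hmass
    exact ENNReal.coe_ne_top hmass
  refine ⟨hI, ?_⟩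
  rw [normalizedDensity_eq_smul hρ]
  have ha0 : (a : ℝ≥0∞) ≠ 0 := by simpa using ha.ne'
  have h1 : ν = (a : ℝ≥0∞)⁻¹ • (a : ℝ≥0∞) • ν := by
    rw [smul_smul, ENNReal.inv_mul_cancel ha0 ENNReal.coe_ne_top, one_smul]
  have h2 : (a : ℝ≥0∞) • ν = ENNReal.ofReal c • v.withDensity fun s ↦ ENNReal.ofReal (ρ s) := h
  rw [h1, h2, smul_smul, hmass, ENNReal.mul_inv (Or.inl hc0) (Or.inl ENNReal.ofReal_ne_top),
    mul_right_comm, ENNReal.inv_mul_cancel hc0 ENNReal.ofReal_ne_top, one_mul]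

end Normalization

/-! ### Dimension bound and the effective loss. -/

section Slice

variable {n m k : ℕ} {Θ : Type*} [TopologicalSpace Θ] [ChartedSpace (EuclideanSpace ℝ (Fin n)) Θ]
  [IsManifold (𝓡 n) ∞ Θ] {χ : Θ → EuclideanSpace ℝ (Fin m)}
  [ChartedSpace (EuclideanSpace ℝ (Fin k)) (χ ⁻¹' {0})]

omit [IsManifold (𝓡 n) ∞ Θ] in
/-- Transversality bounds the dimension of `Θ`. -/
lemma le_add_of_transversal {G : Type*} [TopologicalSpace G]
    [ChartedSpace (EuclideanSpace ℝ (Fin m)) G] [Group G] [MulAction G Θ] {s : χ ⁻¹' {0}}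
    (h : sliceTangent n k χ s ⊔ orbitTangent n m G (s : Θ) = ⊤) : n ≤ m + k := by
  let A : EuclideanSpace ℝ (Fin k) →ₗ[ℝ] EuclideanSpace ℝ (Fin n) :=
    (mfderiv (𝓡 k) (𝓡 n) (Subtype.val : χ ⁻¹' {0} → Θ) s).toLinearMap
  let B : EuclideanSpace ℝ (Fin m) →ₗ[ℝ] EuclideanSpace ℝ (Fin n) :=
    (mfderiv (𝓡 m) (𝓡 n) (fun a : G ↦ a • (s : Θ)) 1).toLinearMap
  have h' : LinearMap.range A ⊔ LinearMap.range B = ⊤ := h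
  have h1 := Submodule.finrank_add_le_finrank_add_finrank (LinearMap.range A) (LinearMap.range B)
  have h2 := LinearMap.finrank_range_le A
  have h3 := LinearMap.finrank_range_le B
  rw [h', finrank_top] at h1
  simp only [finrank_euclideanSpace_fin] at h1 h2 h3
  omega

variable [RiemannianBundle (fun x : Θ ↦ TangentSpace (𝓡 n) x)]

lemma sliceWeight_pos {L : Θ → ℝ} {β σ : ℝ} {θ : Θ}
    (h : 0 < (constraintGram (n := n) χ θ).det) : 0 < sliceWeight n L β σ χ θ :=
  mul_pos (Real.exp_pos _) (one_div_pos.2 (Real.sqrt_pos.2 h))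

/-- Since `(β/σ²) · σ²/(2β) = 1/2`, the correction contributes `exp (-½ log det G_χ)`, which is
`(det G_χ)^(-1/2)` because the determinant is positive. -/
lemma exp_effectiveLoss {L : Θ → ℝ} {β σ : ℝ} (hβ : β ≠ 0) (hσ : σ ≠ 0) {θ : Θ}
    (h : 0 < (constraintGram (n := n) χ θ).det) :
    Real.exp (-(β / σ ^ 2) * effectiveLoss n L β σ χ θ) = sliceWeight n L β σ χ θ := by
  have h1 : -(β / σ ^ 2) * effectiveLoss n L β σ χ θ =
      -(β / σ ^ 2) * L θ + -(Real.log (constraintGram (n := n) χ θ).det / 2) := by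
    rw [effectiveLoss]
    field_simp
    ring
  rw [h1, Real.exp_add, sliceWeight, Real.exp_neg, ← Real.log_sqrt h.le,
    Real.exp_log (Real.sqrt_pos.2 h), one_div]

end Slice

end GaugeSlice

end

/-! ### Existence and density of the gauge-fixed law. -/

theorem theorem1 {n m k : ℕ}
    -- the Riemannian manifold
    {Θ : Type*} [TopologicalSpace Θ] [T2Space Θ] [SecondCountableTopology Θ]
    [MeasurableSpace Θ] [BorelSpace Θ]
    [ChartedSpace (EuclideanSpace ℝ (Fin n)) Θ] [IsManifold (𝓡 n) ∞ Θ]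
    [RiemannianBundle (fun x : Θ ↦ TangentSpace (𝓡 n) x)]
    [IsContMDiffRiemannianBundle (𝓡 n) ∞ (EuclideanSpace ℝ (Fin n))
      (fun x : Θ ↦ TangentSpace (𝓡 n) x)]
    -- the Lie group and its smooth, free and proper action
    {G : Type*} [TopologicalSpace G] [ChartedSpace (EuclideanSpace ℝ (Fin m)) G] [Group G]
    [LieGroup (𝓡 m) ∞ G] [MulAction G Θ] [ContMDiffSMul (𝓡 m) (𝓡 n) ∞ G Θ] [ProperSMul G Θ]
    (hfree : ∀ (a : G) (θ : Θ), a • θ = θ → a = 1)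
    -- the gauge map; the slice is an embedded submanifold cut out regularly
    (χ : Θ → EuclideanSpace ℝ (Fin m)) (hχ : ContMDiff (𝓡 n) (𝓡 m) ∞ χ)
    (hreg : ∀ θ, χ θ = 0 → Function.Surjective (mfderiv (𝓡 n) (𝓡 m) χ θ))
    [ChartedSpace (EuclideanSpace ℝ (Fin k)) (χ ⁻¹' {0})] [IsManifold (𝓡 k) ∞ (χ ⁻¹' {0})]
    (hS : Manifold.IsSmoothEmbedding (𝓡 k) (𝓡 n) ∞ (Subtype.val : χ ⁻¹' {0} → Θ))
    -- it meets each orbit exactly once, and transversally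
    (honce : ∀ θ : Θ, ∃! s : Θ, s ∈ MulAction.orbit G θ ∧ χ s = 0)
    (htrans : ∀ s : χ ⁻¹' {0}, sliceTangent n k χ s ⊔ orbitTangent n m G (s : Θ) = ⊤)
    -- the invariant loss
    (L : Θ → ℝ) (hL : ContMDiff (𝓡 n) 𝓘(ℝ, ℝ) ∞ L) (hinv : ∀ (a : G) (θ : Θ), L (a • θ) = L θ)
    (β σ : ℝ) (hβ : 0 < β) (hσ : 0 < σ)
    -- the Langevin dynamics has the Gibbs measure as a stationary probability measure
    (μ : Measure Θ) [IsProbabilityMeasure μ]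
    {Ω : Type*} [mΩ : MeasurableSpace Ω] (P : Measure Ω) [IsProbabilityMeasure P]
    (ℱ : Filtration ℝ≥0 mΩ) (X : ℝ≥0 → Ω → Θ) (hX : IsLangevinProcess n L β σ P ℱ X)
    (hstat : ∀ t, P.map (X t) = μ)
    (Z : ℝ) (hZ : 0 < Z)
    (hμ : μ = (riemannianVolume (metricTensor n Θ)).withDensity
      fun θ ↦ ENNReal.ofReal (Z⁻¹ * Real.exp (-(β / σ ^ 2) * L θ))) :
    -- the Gram matrix is non-degenerate on the slice
    (∀ s : χ ⁻¹' {0}, 0 < (constraintGram (n := n) χ (s : Θ)).det) ∧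
    -- the constrained measure `δ(χ) dμ`
    IsConstrainedMeasure μ χ ((sliceVolume n k χ).withDensity
      fun s ↦ ENNReal.ofReal (Z⁻¹ * sliceWeight n L β σ χ (s : Θ))) ∧
    -- the conditional law exists if and only if the weight can be normalized
    ∫⁻ s, ENNReal.ofReal (sliceWeight n L β σ χ (s : Θ)) ∂(sliceVolume n k χ) ≠ 0 ∧
    ((∃ ν, IsConditionalLaw μ χ ν) ↔
      ∫⁻ s, ENNReal.ofReal (sliceWeight n L β σ χ (s : Θ)) ∂(sliceVolume n k χ) ≠ ⊤) ∧
    -- its density, in both forms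
    ∀ ν, IsConditionalLaw μ χ ν →
      ν ≪ sliceVolume n k χ ∧
      ν = normalizedDensity (sliceVolume n k χ) (fun s ↦ sliceWeight n L β σ χ (s : Θ)) ∧
      ν = normalizedDensity (sliceVolume n k χ)
        (fun s ↦ Real.exp (-(β / σ ^ 2) * effectiveLoss n L β σ χ (s : Θ))) := by
  have hval : ContMDiff (𝓡 k) (𝓡 n) ∞ (Subtype.val : χ ⁻¹' {0} → Θ) := hS.contMDiff
  have hLc : LocallyCompactSpace Θ := ChartedSpace.locallyCompactSpace (EuclideanSpace ℝ (Fin n)) Θ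
  have hne : Nonempty Θ := by
    by_contra h
    rw [not_nonempty_iff] at h
    exact IsProbabilityMeasure.ne_zero μ (Measure.eq_zero_of_isEmpty μ)
  -- A probability measure needs a point, and the orbit of that point meets the slice.
  obtain ⟨s₀⟩ : Nonempty (χ ⁻¹' {0}) := by
    obtain ⟨s, ⟨-, hs⟩, -⟩ := honce hne.some
    exact ⟨⟨s, hs⟩⟩
  have hdim : m + k = n :=
    (add_le_of_slice hχ hreg hS s₀).antisymm (le_add_of_transversal (htrans s₀))
  let ε : Fin m ⊕ Fin k ≃ Fin n := finSumFinEquiv.trans (finCongr hdim)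
  have hadapted := exists_adapted_chart hχ hreg hS ε
  have hdet : ∀ s : χ ⁻¹' {0}, 0 < (constraintGram (n := n) χ (s : Θ)).det := fun s ↦ by
    obtain ⟨e, d, h, hs⟩ := hadapted s
    exact (h.chartDensity_mul_sqrt hχ hval hs).1
  have hwcont : Continuous fun s : χ ⁻¹' {0} ↦ sliceWeight n L β σ χ (s : Θ) := by
    refine Continuous.mul ?_ (continuous_iff_continuousAt.2 fun s ↦ ?_)
    · exact Real.continuous_exp.comp
        (continuous_const.mul (hL.continuous.comp continuous_subtype_val))
    · obtain ⟨e, d, h, hs⟩ := hadapted s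
      exact h.continuousAt_inv_sqrt hχ hval hs
  have hwpos : ∀ s : χ ⁻¹' {0}, 0 < sliceWeight n L β σ χ (s : Θ) := fun s ↦
    sliceWeight_pos (hdet s)
  have hconstr : IsConstrainedMeasure μ χ ((sliceVolume n k χ).withDensity
      fun s ↦ ENNReal.ofReal (Z⁻¹ * sliceWeight n L β σ χ (s : Θ))) := by
    have hlf : IsLocallyFiniteMeasure (sliceVolume n k χ) :=
      isLocallyFiniteMeasure_riemannianVolume (inducedMetric_isRegular hval)
    refine isConstrainedMeasure_of_local hχ.continuous
      (IsLocallyFiniteMeasure.withDensity_ofReal (continuous_const.mul hwcont)) fun s ↦ ?_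
    obtain ⟨e, d, h, hs⟩ := hadapted s
    refine ⟨e.source, e.open_source, hs, fun η hη hηb hηc hη1 f hf hfc hfe ↦ ?_⟩
    rw [hμ]
    refine h.tendsto_integral hχ hval
      (continuous_const.mul (Real.continuous_exp.comp (continuous_const.mul hL.continuous)))
      (fun θ ↦ mul_nonneg (inv_pos.2 hZ).le (Real.exp_pos _).le)
      (continuous_const.mul hwcont).measurable (fun s ↦ ?_) hη hηb hηc hη1 hf hfc hfe
    exact (mul_assoc _ _ _).symm
  have hmass : ∫⁻ s, ENNReal.ofReal (sliceWeight n L β σ χ (s : Θ)) ∂(sliceVolume n k χ) ≠ 0 := by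
    obtain ⟨e, d, h, hs⟩ := hadapted s₀
    exact lintegral_riemannianVolume_ne_zero (inducedMetric_isRegular hval) h.mem_slice_atlas
      (h.slice s₀ hs).1 (h.chartDensity_mul_sqrt hχ hval hs).2.1 hwcont.measurable hwpos
  have hZ' : 0 < Z⁻¹ := inv_pos.2 hZ
  have hcond : ∀ ν, IsConditionalLaw μ χ ν →
      ∫⁻ s, ENNReal.ofReal (sliceWeight n L β σ χ (s : Θ)) ∂(sliceVolume n k χ) ≠ ⊤ ∧
      ν = normalizedDensity (sliceVolume n k χ) (fun s ↦ sliceWeight n L β σ χ (s : Θ)) := by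
    rintro ν ⟨hν, a, ha, hcν⟩
    exact eq_normalizedDensity_of_smul_eq hwcont.measurable hZ' ha
      (hcν.unique hχ.continuous hconstr)
  refine ⟨hdet, hconstr, hmass, ⟨fun ⟨ν, hν⟩ ↦ (hcond ν hν).1, fun htop ↦ ?_⟩, fun ν hν ↦ ?_⟩
  -- The constant is the total mass `Z⁻¹ Z_S` of the constrained measure, finite by assumption and
  -- positive by `hmass`.
  · refine ⟨_, isProbabilityMeasure_normalizedDensity hwcont.measurable hmass htop,
      Z⁻¹.toNNReal * (∫⁻ s, ENNReal.ofReal (sliceWeight n L β σ χ (s : Θ))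
        ∂(sliceVolume n k χ)).toNNReal,
      mul_pos (Real.toNNReal_pos.2 hZ') (ENNReal.toNNReal_pos hmass htop), ?_⟩
    rw [mul_smul, toNNReal_smul_normalizedDensity hwcont.measurable hmass htop]
    rwa [withDensity_ofReal_const_mul hZ'.le hwcont.measurable] at hconstr
  · have h1 := (hcond ν hν).2
    refine ⟨?_, h1, ?_⟩
    · rw [h1]
      exact withDensity_absolutelyContinuous _ _
    · simp only [exp_effectiveLoss hβ.ne' hσ.ne' (hdet _)]
      exact h1
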